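/- Theorem 2.2. Fix an integer $\ell\ge 1$. Let $n=2\ell m+r$ with integers $m\ge 1$ and $r\in\{-1,\dots,2\ell-2\}$, and let $$T_n(x)=\sum_{j=0}^n\bigl(a_j\cos(jx)+b_j\sin(jx)\bigr),\qquad x\in(0,2\pi),$$ be a random trigonometric polynomial with real random coefficients $a_0,\dots,a_n,b_0,\dots,b_n$ defined on one probability space. For $i=0,\dots,2m-1$ define the blocks of length $\ell$ $$A_i=(a_{\ell i},a_{\ell i+1},\dots,a_{\ell i+\ell-1}),\qquad B_i=(b_{\ell i},b_{\ell i+1},\dots,b_{\ell i+\ell-1}),$$ and let $\tilde A=(a_{2\ell m},\dots,a_n)$ and $\tilde B=(b_{2\ell m},\dots,b_n)$ be the $r+1$ remaining coefficients of each kind (none if $r=-1$). Suppose that $A_{2j}=A_{2j+1}$ and $B_{2j}=B_{2j+1}$ almost surely for $j=0,\dots,m-1$, and that the coefficients in the blocks $A_{2j}$, $B_{2j}$ ($0\le j\le m-1$) together with those in $\tilde A$ and $\tilde B$ form a family of independent random variables, each with Gaussian distribution $\mathcal N(0,\sigma^2)$, $\sigma>0$. Let $N_n(0,2\pi)$ be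 the number of distinct zeros of $T_n$ in $(0,2\pi)$. Then $N_n(0,2\pi)$ is almost surely finite and integrable, and $$\mathbb E[N_n(0,2\pi)]=\frac{2n}{\sqrt3}+\mathcal O\bigl(n^{4/5}\bigr)\qquad\text{as } n\to\infty,$$ where the implied constant, and the size of $n$ from which on the bound holds, depend only on $\ell$. -/

import Mathlib

open MeasureTheory ProbabilityTheory

/-- The trigonometric polynomial `∑_{j=0}^n (a_j cos (j x) + b_j sin (j x))`. -/
noncomputable def trigPoly (n : ℕ) (a b : ℕ → ℝ) (x : ℝ) : ℝ :=
  ∑ j ∈ Finset.range (n + 1), (a j * Real.cos (j * x) + b j * Real.sin (j * x))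

/-- The set of real zeros of the trigonometric polynomial in the open interval `(0, 2π)`. -/
def trigZeros (n : ℕ) (a b : ℕ → ℝ) : Set ℝ :=
  {x : ℝ | x ∈ Set.Ioo 0 (2 * Real.pi) ∧ trigPoly n a b x = 0}

/-- `N_n(0, 2π)`: the number of (distinct) real zeros in `(0, 2π)`. If the zero set is infinite
(the zero polynomial), `Set.ncard` is `0`; the theorem asserts that this has probability zero. -/
noncomputable def numTrigZeros (n : ℕ) (a b : ℕ → ℝ) : ℕ :=
  (trigZeros n a b).ncard

/-- The `i`-th block of length `ℓ`, `(c_{ℓ i}, c_{ℓ i + 1}, …, c_{ℓ i + ℓ - 1})`. -/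
def coeffBlock {Ω : Type*} (ℓ : ℕ) (c : ℕ → Ω → ℝ) (i : ℕ) : Fin ℓ → Ω → ℝ :=
  fun k => c (ℓ * i + k)

/-- The positions of the free coefficients among `0, …, n`: those in the blocks number
`0, 2, …, 2 (m - 1)` of length `ℓ`, and the positions left over after the first `2 m` blocks. -/
def freeIndices (ℓ m n : ℕ) : Set ℕ :=
  {i | ∃ j < m, ∃ k < ℓ, i = ℓ * (2 * j) + k} ∪ {i | 2 * ℓ * m ≤ i ∧ i ≤ n}

/-- The random coefficients `a_0, …, a_n, b_0, …, b_n` have pairwise equal consecutive blocks of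
length `ℓ` (`A_{2j} = A_{2j+1}` and `B_{2j} = B_{2j+1}` for `j < m`, as random variables, i.e.
almost surely), and the free coefficients (cosine and sine ones jointly) are i.i.d. with law
`N(0, σ²)`. -/
structure HasEqualConsecutiveBlocks {Ω : Type*} [MeasurableSpace Ω] (P : Measure Ω)
    (ℓ m n : ℕ) (σ : NNReal) (a b : ℕ → Ω → ℝ) : Prop where
  cos_blocks : ∀ j < m, ∀ k : Fin ℓ,
    coeffBlock ℓ a (2 * j) k =ᵐ[P] coeffBlock ℓ a (2 * j + 1) k
  sin_blocks : ∀ j < m, ∀ k : Fin ℓ,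
    coeffBlock ℓ b (2 * j) k =ᵐ[P] coeffBlock ℓ b (2 * j + 1) k
  cos_law : ∀ i ∈ freeIndices ℓ m n, HasLaw (a i) (gaussianReal 0 (σ ^ 2)) P
  sin_law : ∀ i ∈ freeIndices ℓ m n, HasLaw (b i) (gaussianReal 0 (σ ^ 2)) P
  indep : iIndepFun
    (Sum.elim (fun i : freeIndices ℓ m n => a i) (fun i : freeIndices ℓ m n => b i)) P

/-!
The number of zeros of a trigonometric polynomial with equal consecutive blocks of Gaussian
coefficients is computed exactly in the mean by a Kac-Rice formula, and the resulting integral is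
then estimated.

**Reduction.** Equal coefficients at the positions `i` and `i + ℓ` combine, by the sum-to-product
formulas, to the frequency `i + ℓ / 2` with amplitude `c x = 2 cos (ℓ x / 2)`. The polynomial is thus
almost surely `∑ i, ξ i * Φ i x` with i.i.d. Gaussian `ξ i` (`trigPoly_eq_sum_waveform`).

**Kac-Rice formula.** Let `U` be an open set on which some `Φ i₀` has no zero. After division by
`Φ i₀` the zeros in `U` are the solutions of `h x = ξ i₀`, where `h` depends only on the other
coefficients. For fixed `h` the mean number of solutions is given by the area formula with
multiplicity (`lintegral_count_preimage_mul`), in which critical points of `h` play no role because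
critical values form a null set. By Tonelli, the mean over the other coefficients becomes, for each
`x`, the expectation of `|X|` times a Gaussian density in `Y` for a Gaussian pair `(X, Y)`
(`lintegral_abs_mul_gaussianPDF`). The result is `lintegral_count_zeros_sum_mul`: the density of
zeros is `1 / π` times the square root of the Gram determinant of `Φ` and `Φ'`, divided by
`∑ i, Φ i x ^ 2`. Tonelli needs that the number of zeros is measurable in the coefficients
(`measurable_count_zeros`). Here `Φ i₀` is `2 cos (ℓ x / 2) ^ 2`; its zeros in `(0, 2π)` are finitely
many, so they contribute only a bounded error.

**Estimate.** With `N = m ℓ` paired frequencies of mean square `s = n² / 3 + O(n)` and a remainder of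
`M < 2 ℓ` terms, the variance is `N c² + M`. The density differs from `√s / π` by
`O(n / (1 + N c²))` (`abs_zeroDensity_sub_sqrt_mul_le`), and the integral of this error over
`(0, 2π)` is `O(√n)` since `∫ dx / (1 + K cos² (ℓ x / 2))` is at most `π² / √K`
(`integral_inv_one_add_mul_cos_sq_le`). The main term is `2 √s = 2 n / √3 + O(1)`.
-/

/-! ### Counting solutions of `h x = y` -/

open Set in
lemma exists_rat_Icc_subset {O : Set ℝ} (hO : IsOpen O) {x : ℝ} (hx : x ∈ O) :
    ∃ p q : ℚ, (p : ℝ) < x ∧ x < q ∧ Icc (p : ℝ) q ⊆ O := by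
  obtain ⟨ε, hε, hb⟩ := Metric.isOpen_iff.1 hO x hx
  obtain ⟨p, hp1, hp2⟩ := exists_rat_btwn (show x - ε < x by linarith)
  obtain ⟨q, hq1, hq2⟩ := exists_rat_btwn (show x < x + ε by linarith)
  refine ⟨p, q, hp2, hq1, fun y hy => hb ?_⟩
  rw [Metric.mem_ball, Real.dist_eq, abs_lt]
  constructor <;> linarith [hy.1, hy.2]

open Set in
lemma exists_open_injOn_of_hasDerivAt_ne_zero {U : Set ℝ} (hU : IsOpen U) {h h' : ℝ → ℝ}
    (hd : ∀ x ∈ U, HasDerivAt h (h' x) x) (hc : ContinuousOn h' U) {x : ℝ} (hx : x ∈ U)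
    (hx0 : h' x ≠ 0) : ∃ O, IsOpen O ∧ x ∈ O ∧ O ⊆ U ∧ InjOn h O := by
  have hs : HasStrictDerivAt h (h' x) x := by
    refine hasStrictDerivAt_of_hasDerivAt_of_continuousAt ?_ (hc.continuousAt (hU.mem_nhds hx))
    filter_upwards [hU.mem_nhds hx] with y hy using hd y hy
  let e := (hs.hasStrictFDerivAt_equiv hx0).toOpenPartialHomeomorph h
  have hxe : x ∈ e.source :=
    (hs.hasStrictFDerivAt_equiv hx0).mem_toOpenPartialHomeomorph_source
  exact ⟨U ∩ e.source, hU.inter e.open_source, ⟨hx, hxe⟩, inter_subset_left,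
    e.injOn.mono inter_subset_right⟩

open Set in
/-- The area formula in dimension one, with multiplicity: integrating the number of solutions
`x ∈ U` of `h x = y` against a weight `p y` gives the integral of `|h'| * (p ∘ h)` over `U`. -/
lemma lintegral_count_preimage_mul {U : Set ℝ} (hU : IsOpen U) {h h' : ℝ → ℝ}
    (hd : ∀ x ∈ U, HasDerivAt h (h' x) x) (hc : ContinuousOn h' U) {p : ℝ → ENNReal}
    (hp : Measurable p) :
    ∫⁻ y, Measure.count (U ∩ h ⁻¹' {y}) * p y = ∫⁻ x in U, ENNReal.ofReal |h' x| * p (h x) := by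
  classical
  obtain ⟨f, hf⟩ := exists_surjective_nat (ℚ × ℚ)
  let V : ℕ → Set ℝ := fun k =>
    if InjOn h (Icc ((f k).1 : ℝ) (f k).2) ∧ Icc ((f k).1 : ℝ) (f k).2 ⊆ U
    then Icc ((f k).1 : ℝ) (f k).2 else ∅
  have hVm : ∀ k, MeasurableSet (V k) := fun k => by
    dsimp only [V]; split_ifs
    exacts [measurableSet_Icc, MeasurableSet.empty]
  have hVU : ∀ k, V k ⊆ U := fun k => by
    dsimp only [V]; split_ifs with H
    exacts [H.2, empty_subset _]
  have hVi : ∀ k, InjOn h (V k) := fun k => by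
    dsimp only [V]; split_ifs with H
    exacts [H.1, injOn_empty _]
  have hVx : ∀ x ∈ U, h' x ≠ 0 → x ∈ ⋃ k, V k := by
    intro x hx hx0
    obtain ⟨O, hO, hxO, hOU, hOi⟩ := exists_open_injOn_of_hasDerivAt_ne_zero hU hd hc hx hx0
    obtain ⟨a, b, ha, hb, hab⟩ := exists_rat_Icc_subset hO hxO
    obtain ⟨k, hk⟩ := hf (a, b)
    refine mem_iUnion.2 ⟨k, ?_⟩
    have : V k = Icc (a : ℝ) b := by
      dsimp only [V]
      rw [hk, if_pos ⟨hOi.mono hab, hab.trans hOU⟩]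
    rw [this]
    exact ⟨ha.le, hb.le⟩
  let s : ℕ → Set ℝ := disjointed V
  have hsV : ∀ k, s k ⊆ V k := fun k => disjointed_subset V k
  have hsm : ∀ k, MeasurableSet (s k) := fun k => MeasurableSet.disjointed hVm k
  have hsd : Pairwise (Function.onFun Disjoint s) := disjoint_disjointed V
  have hsU : ⋃ k, s k = ⋃ k, V k := iUnion_disjointed
  have hsi : ∀ k, InjOn h (s k) := fun k => (hVi k).mono (hsV k)
  have hsd' : ∀ k, ∀ x ∈ s k, HasDerivWithinAt h (h' x) (s k) x := fun k x hx =>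
    (hd x (hVU k (hsV k hx))).hasDerivWithinAt
  have hWm : MeasurableSet (⋃ k, s k) := MeasurableSet.iUnion hsm
  have hWU : ⋃ k, s k ⊆ U := iUnion_subset fun k => (hsV k).trans (hVU k)
  have hNd : ∀ x ∈ U \ ⋃ k, s k, h' x = 0 := by
    intro x hx
    by_contra h0
    exact hx.2 (hsU ▸ hVx x hx.1 h0)
  -- `U \ ⋃ k, s k` consists of critical points, and critical values form a null set
  have hnull : volume (h '' (U \ ⋃ k, s k)) = 0 := by
    refine addHaar_image_eq_zero_of_det_fderivWithin_eq_zero volume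
      (f' := fun x => ContinuousLinearMap.toSpanSingleton ℝ (h' x))
      (fun x hx => (hd x hx.1).hasDerivWithinAt.hasFDerivWithinAt) fun x hx => ?_
    rw [hNd x hx]
    simp
  have hcount : ∀ᵐ y, Measure.count (U ∩ h ⁻¹' {y}) * p y
      = ∑' k, (h '' s k).indicator p y := by
    filter_upwards [compl_mem_ae_iff.2 hnull] with y hy
    have h1 : U ∩ h ⁻¹' {y} = ⋃ k, s k ∩ h ⁻¹' {y} := by
      rw [← iUnion_inter]
      refine Subset.antisymm (fun x hx => ⟨?_, hx.2⟩) (inter_subset_inter_left _ hWU)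
      by_contra hxW
      exact hy ⟨x, ⟨hx.1, hxW⟩, hx.2⟩
    have h2 : ∀ k, (s k ∩ h ⁻¹' {y}).Subsingleton := fun k x hx z hz =>
      hsi k hx.1 hz.1 ((show h x = y from hx.2).trans (show h z = y from hz.2).symm)
    rw [h1, measure_iUnion, ← ENNReal.tsum_mul_right]
    · refine tsum_congr fun k => ?_
      by_cases hk : y ∈ h '' s k
      · obtain ⟨x, hx, rfl⟩ := hk
        have : s k ∩ h ⁻¹' {h x} = {x} :=
          (h2 k).eq_singleton_of_mem ⟨hx, rfl⟩
        rw [this, indicator_of_mem (mem_image_of_mem h hx)]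
        simp
      · have : s k ∩ h ⁻¹' {y} = ∅ := by
          rw [eq_empty_iff_forall_notMem]
          exact fun x hx => hk ⟨x, hx.1, hx.2⟩
        rw [this, indicator_of_notMem hk]
        simp
    · exact fun i j hij => (hsd hij).mono inter_subset_left inter_subset_left
    · exact fun k => (h2 k).measurableSet
  have hsc : ∀ k, ContinuousOn h (s k) := fun k x hx => (hsd' k x hx).continuousWithinAt
  have hsim : ∀ k, MeasurableSet (h '' s k) := fun k =>
    (hsm k).image_of_continuousOn_injOn (hsc k) (hsi k)
  rw [lintegral_congr_ae hcount, lintegral_tsum fun k => (hp.indicator (hsim k)).aemeasurable]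
  calc ∑' k, ∫⁻ y, (h '' s k).indicator p y
      = ∑' k, ∫⁻ x in s k, ENNReal.ofReal |h' x| * p (h x) := by
        refine tsum_congr fun k => ?_
        rw [lintegral_indicator (hsim k),
          lintegral_image_eq_lintegral_abs_deriv_mul (hsm k) (hsd' k) (hsi k)]
    _ = ∫⁻ x in ⋃ k, s k, ENNReal.ofReal |h' x| * p (h x) := (lintegral_iUnion hsm hsd _).symm
    _ = ∫⁻ x in U, ENNReal.ofReal |h' x| * p (h x) := by
        rw [← inter_union_sdiff U (⋃ k, s k), inter_eq_self_of_subset_right hWU,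
          lintegral_union (hU.measurableSet.diff hWm) disjoint_sdiff_right]
        rw [setLIntegral_congr_fun (g := fun _ => 0) (hU.measurableSet.diff hWm)
          (fun x hx => by simp [hNd x hx])]
        simp

open Set in
/-- By compactness, a continuous function has a zero in a closed interval if and only if it takes
arbitrarily small values at rational points of the interval. -/
lemma measurableSet_exists_zero_Icc {Ω : Type*} [MeasurableSpace Ω] {f : Ω → ℝ → ℝ} {p q : ℚ}
    (hpq : p < q) (hf : ∀ x ∈ Icc (p : ℝ) q, Measurable fun ω => f ω x)
    (hc : ∀ ω, ContinuousOn (f ω) (Icc (p : ℝ) q)) :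
    MeasurableSet {ω | ∃ x ∈ Icc (p : ℝ) q, f ω x = 0} := by
  have hpq' : (p : ℝ) < q := by exact_mod_cast hpq
  have : {ω | ∃ x ∈ Icc (p : ℝ) q, f ω x = 0} =
      ⋂ n : ℕ, ⋃ r ∈ {r : ℚ | (r : ℝ) ∈ Icc (p : ℝ) q}, {ω | |f ω r| < 1 / ((n : ℝ) + 1)} := by
    ext ω
    simp only [mem_ofPred_eq, mem_iInter, mem_iUnion, exists_prop]
    constructor
    · rintro ⟨x, hx, hfx⟩ n
      have hn : (0 : ℝ) < 1 / ((n : ℝ) + 1) := by positivity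
      obtain ⟨O, hO, hxO, hOs⟩ := mem_nhdsWithin.1
        (((hc ω).abs x hx).eventually (Iio_mem_nhds
          (show |f ω x| < 1 / ((n : ℝ) + 1) by rw [hfx, abs_zero]; exact hn)))
      have hcl : x ∈ closure (Ioo (p : ℝ) q) := by rwa [closure_Ioo hpq'.ne]
      obtain ⟨r, hr⟩ := Rat.denseRange_cast.exists_mem_open (hO.inter isOpen_Ioo)
        (mem_closure_iff.1 hcl O hO hxO)
      exact ⟨r, Ioo_subset_Icc_self hr.2, hOs ⟨hr.1, Ioo_subset_Icc_self hr.2⟩⟩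
    · intro H
      obtain ⟨x, hx, hmin⟩ := isCompact_Icc.exists_isMinOn (nonempty_Icc.2 hpq'.le) (hc ω).abs
      refine ⟨x, hx, ?_⟩
      by_contra h0
      obtain ⟨n, hn⟩ := exists_nat_one_div_lt (abs_pos.2 h0)
      obtain ⟨r, hr, hr'⟩ := H n
      have := hmin hr
      simp only [mem_ofPred_eq] at this
      linarith
  rw [this]
  refine MeasurableSet.iInter fun n => MeasurableSet.biUnion (to_countable _) fun r hr => ?_
  exact measurableSet_lt (hf r hr).abs measurable_const

open Set in
/-- The number of zeros in an open set of a random continuous function is a random variable. -/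
lemma measurable_count_zeros {Ω : Type*} [MeasurableSpace Ω] {f : Ω → ℝ → ℝ} {U : Set ℝ}
    (hU : IsOpen U) (hf : ∀ x ∈ U, Measurable fun ω => f ω x) (hc : ∀ ω, ContinuousOn (f ω) U) :
    Measurable fun ω => Measure.count (U ∩ f ω ⁻¹' {0}) := by
  classical
  let I : ℚ × ℚ → Set ℝ := fun q => Icc (q.1 : ℝ) q.2
  let good : Set (Finset (ℚ × ℚ)) := {F | (∀ q ∈ F, q.1 < q.2 ∧ I q ⊆ U) ∧
    (F : Set (ℚ × ℚ)).PairwiseDisjoint I}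
  let A : ℚ × ℚ → Set Ω := fun q => {ω | ∃ x ∈ I q, f ω x = 0}
  -- the number of zeros is the largest number of disjoint rational intervals containing one
  have key : (fun ω => Measure.count (U ∩ f ω ⁻¹' {0})) =
      fun ω => ⨆ F ∈ good, ∑ q ∈ F, (A q).indicator (fun _ => (1 : ENNReal)) ω := by
    funext ω
    have hm : ∀ q ∈ {q : ℚ × ℚ | I q ⊆ U}, MeasurableSet (I q ∩ f ω ⁻¹' {0}) := fun q hq =>
      ((hc ω).mono hq |>.preimage_isClosed_of_isClosed isClosed_Icc isClosed_singleton).measurableSet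
    apply le_antisymm
    · refine ENNReal.le_of_forall_nnreal_lt fun r hr => ?_
      obtain ⟨n, hn⟩ := exists_nat_ge r
      have hT : ∃ T : Finset ℝ, (T : Set ℝ) ⊆ U ∩ f ω ⁻¹' {0} ∧ (r : ENNReal) ≤ T.card := by
        by_cases hfin : (U ∩ f ω ⁻¹' {0}).Finite
        · refine ⟨hfin.toFinset, by simp, ?_⟩
          rw [Measure.count_apply_finite _ hfin] at hr
          exact hr.le
        · obtain ⟨T, hT, hTc⟩ := Set.Infinite.exists_subset_card_eq hfin n
          exact ⟨T, hT, by rw [hTc]; exact_mod_cast hn⟩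
      obtain ⟨T, hTU, hrT⟩ := hT
      obtain ⟨W, hW, hWd⟩ := T.finite_toSet.t2_separation
      have : ∀ x ∈ T, ∃ q : ℚ × ℚ, (q.1 : ℝ) < x ∧ x < q.2 ∧ I q ⊆ W x ∩ U := fun x hx => by
        obtain ⟨a, b, h1, h2, h3⟩ := exists_rat_Icc_subset ((hW x).2.inter hU) ⟨(hW x).1, (hTU hx).1⟩
        exact ⟨(a, b), h1, h2, h3⟩
      choose! g hg1 hg2 hg3 using this
      have hgW : ∀ x ∈ T, ∀ y ∈ T, x ≠ y → Disjoint (I (g x)) (I (g y)) := fun x hx y hy hxy =>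
        (hWd hx hy hxy).mono ((hg3 x hx).trans inter_subset_left)
          ((hg3 y hy).trans inter_subset_left)
      have hgm : ∀ x ∈ T, x ∈ I (g x) := fun x hx => ⟨(hg1 x hx).le, (hg2 x hx).le⟩
      have hginj : InjOn g T := fun x hx y hy hxy => by
        by_contra hne
        exact (disjoint_left.1 (hgW x hx y hy hne) (hgm x hx)) (hxy ▸ hgm x hx)
      have hF : T.image g ∈ good := by
        refine ⟨fun q hq => ?_, fun q hq q' hq' hne => ?_⟩
        · obtain ⟨x, hx, rfl⟩ := Finset.mem_image.1 hq
          exact ⟨by exact_mod_cast (hg1 x hx).trans (hg2 x hx),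
            (hg3 x hx).trans inter_subset_right⟩
        · obtain ⟨x, hx, rfl⟩ := Finset.mem_image.1 (Finset.mem_coe.1 hq)
          obtain ⟨y, hy, rfl⟩ := Finset.mem_image.1 (Finset.mem_coe.1 hq')
          exact hgW x hx y hy fun h => hne (h ▸ rfl)
      refine le_trans ?_ (le_iSup₂_of_le (T.image g) hF le_rfl)
      rw [Finset.sum_image hginj, Finset.sum_congr rfl (g := fun _ => (1 : ENNReal))]
      · simpa using hrT
      · intro x hx
        exact indicator_of_mem (show ω ∈ A (g x) from ⟨x, hgm x hx, (hTU hx).2⟩) _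
    · refine iSup₂_le fun F hF => ?_
      calc ∑ q ∈ F, (A q).indicator (fun _ => (1 : ENNReal)) ω
          ≤ ∑ q ∈ F, Measure.count (I q ∩ f ω ⁻¹' {0}) := by
            refine Finset.sum_le_sum fun q _ => ?_
            by_cases h : ω ∈ A q
            swap
            · rw [indicator_of_notMem h]
              exact zero_le
            rw [indicator_of_mem h]
            obtain ⟨x, hx, hfx⟩ := h
            rw [← Measure.count_singleton x]
            exact measure_mono (singleton_subset_iff.2 ⟨hx, hfx⟩)
        _ = Measure.count (⋃ q ∈ F, I q ∩ f ω ⁻¹' {0}) :=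
            (measure_biUnion_finset (fun q hq q' hq' hne =>
              (hF.2 hq hq' hne).mono inter_subset_left inter_subset_left)
              fun q hq => hm q (hF.1 q hq).2).symm
        _ ≤ _ := measure_mono (iUnion₂_subset fun q hq =>
            inter_subset_inter_left _ (hF.1 q hq).2)
  rw [key]
  refine Measurable.biSup _ (to_countable _) fun F hF => ?_
  refine Finset.measurable_fun_sum _ fun q hq => measurable_const.indicator ?_
  exact measurableSet_exists_zero_Icc (hF.1 q hq).1 (fun x hx => hf x ((hF.1 q hq).2 hx))
    fun ω => (hc ω).mono (hF.1 q hq).2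

/-! ### A Gaussian expectation -/

open Real in
/-- The first absolute moment of a centred Gaussian. -/
lemma lintegral_abs_gaussianReal (w : NNReal) :
    ∫⁻ x, ENNReal.ofReal |x| ∂(gaussianReal 0 w) = ENNReal.ofReal √(2 * w / π) := by
  rcases eq_or_ne w 0 with rfl | hw
  · simp
  have hw' : (0 : ℝ) < w := by positivity
  have hb : (0 : ℝ) < 1 / (2 * w) := by positivity
  have hint : ∫ x : ℝ, |x| * gaussianPDFReal 0 w x = √(2 * w / π) := by
    have h1 : ∀ x : ℝ, |x| * gaussianPDFReal 0 w x
        = (fun y => (√(2 * π * w))⁻¹ * (y * rexp (-(1 / (2 * w)) * y ^ 2))) |x| := by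
      intro x
      simp only [gaussianPDFReal, sq_abs, sub_zero]
      rw [show -x ^ 2 / (2 * (w : ℝ)) = -(1 / (2 * w)) * x ^ 2 by ring]
      ring
    have h2 : ∫ x in Set.Ioi (0 : ℝ), x * rexp (-(1 / (2 * w)) * x ^ 2) = w := by
      have := integral_rpow_mul_exp_neg_mul_rpow (p := 2) (q := 1) two_pos (by norm_num) hb
      simp only [rpow_one, rpow_two] at this
      rw [this]
      norm_num
      rw [Real.rpow_neg_one]
      field_simp
    rw [integral_congr_ae (ae_of_all _ h1), integral_comp_abs
      (f := fun y : ℝ => (√(2 * π * w))⁻¹ * (y * rexp (-(1 / (2 * w)) * y ^ 2))),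
      integral_const_mul, h2]
    rw [show 2 * (w : ℝ) / π = (2 * w) ^ 2 / (2 * π * w) by field_simp,
      Real.sqrt_div (by positivity), Real.sqrt_sq (by positivity)]
    ring
  have hi : Integrable (fun x : ℝ => |x| * gaussianPDFReal 0 w x) := by
    by_contra h
    rw [integral_undef h] at hint
    have : 0 < √(2 * w / π) := by positivity
    linarith
  rw [gaussianReal_of_var_ne_zero _ hw, lintegral_withDensity_eq_lintegral_mul _ (by fun_prop)
    (by fun_prop), ← hint, ofReal_integral_eq_lintegral_ofReal hi
    (ae_of_all _ fun x => mul_nonneg (abs_nonneg x) (gaussianPDFReal_nonneg _ _ _))]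
  refine lintegral_congr fun x => ?_
  rw [ENNReal.ofReal_mul (abs_nonneg x), mul_comm]
  rfl

open Real in
/-- The product of two centred Gaussian densities is a multiple of a third one. -/
lemma gaussianPDF_mul_gaussianPDF {u v : NNReal} (hu : u ≠ 0) (hv : v ≠ 0) (y : ℝ) :
    gaussianPDF 0 u y * gaussianPDF 0 v y =
      ENNReal.ofReal (√(2 * π * (u + v)))⁻¹ * gaussianPDF 0 (u * v / (u + v)) y := by
  have hu' : (0 : ℝ) < u := by positivity
  have hv' : (0 : ℝ) < v := by positivity
  simp only [gaussianPDF]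
  rw [← ENNReal.ofReal_mul (gaussianPDFReal_nonneg _ _ _), ← ENNReal.ofReal_mul (by positivity)]
  congr 1
  simp only [gaussianPDFReal, NNReal.coe_div, NNReal.coe_mul, NNReal.coe_add]
  rw [mul_mul_mul_comm, ← mul_assoc (√(2 * π * (u + v)))⁻¹, ← Real.exp_add, ← mul_inv, ← mul_inv,
    ← Real.sqrt_mul (by positivity), ← Real.sqrt_mul (by positivity)]
  congr 2
  · congr 1
    field_simp
  · field_simp
    ring

lemma lintegral_mul_gaussianPDF {u v : NNReal} (hu : u ≠ 0) (hv : v ≠ 0) {f : ℝ → ENNReal}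
    (hf : Measurable f) :
    ∫⁻ y, f y * gaussianPDF 0 u y ∂(gaussianReal 0 v) =
      ENNReal.ofReal (√(2 * Real.pi * (u + v)))⁻¹ *
        ∫⁻ y, f y ∂(gaussianReal 0 (u * v / (u + v))) := by
  have h0 : u * v / (u + v) ≠ 0 := by positivity
  rw [gaussianReal_of_var_ne_zero _ hv, gaussianReal_of_var_ne_zero _ h0,
    lintegral_withDensity_eq_lintegral_mul _ (by fun_prop) (by fun_prop),
    lintegral_withDensity_eq_lintegral_mul _ (by fun_prop) (by fun_prop),
    ← lintegral_const_mul _ (by fun_prop)]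
  refine lintegral_congr fun y => ?_
  simp only [Pi.mul_apply]
  rw [← mul_assoc (ENNReal.ofReal _), ← gaussianPDF_mul_gaussianPDF hu hv]
  ring

open Real in
/-- For a centred Gaussian pair `(X, Y)` the mean of `|X|` weighted by a Gaussian density in `Y`.
If `a` is an independent Gaussian variable of variance `v`, this is the integral of `|X|` over the
event `Y = a`, as it occurs in the Kac-Rice formula. -/
lemma lintegral_abs_mul_gaussianPDF {Ω : Type*} [MeasurableSpace Ω] {P : Measure Ω}
    [IsProbabilityMeasure P] {X Y : Ω → ℝ} (hXY : HasGaussianLaw (fun ω => (X ω, Y ω)) P)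
    (hX0 : P[X] = 0) (hY0 : P[Y] = 0) (hY : 0 < Var[Y; P]) {v : NNReal} (hv : v ≠ 0) :
    ∫⁻ ω, ENNReal.ofReal |X ω| * gaussianPDF 0 v (Y ω) ∂P =
      ENNReal.ofReal (1 / π * (√(Var[X; P] * (Var[Y; P] + v) - cov[X, Y; P] ^ 2)
        / (Var[Y; P] + v))) := by
  have hv' : (0 : ℝ) < v := by positivity
  set α := Var[X; P] with hα
  set γ := Var[Y; P] with hγ
  set β := cov[X, Y; P] with hβ
  set t := β / γ with ht
  have hX2 : MemLp X 2 P := hXY.fst.memLp_two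
  have hY2 : MemLp Y 2 P := hXY.snd.memLp_two
  -- the residual of the regression of `X` on `Y` is independent of `Y`
  set Z : Ω → ℝ := fun ω => X ω - t * Y ω with hZ
  have hZY : HasGaussianLaw (fun ω => (Z ω, Y ω)) P :=
    hXY.map_fun (((ContinuousLinearMap.fst ℝ ℝ ℝ) - t • (ContinuousLinearMap.snd ℝ ℝ ℝ)).prod
      (ContinuousLinearMap.snd ℝ ℝ ℝ))
  have htY : MemLp (fun ω => t * Y ω) 2 P := hY2.const_mul t
  have hcov : cov[Z, Y; P] = 0 := by
    rw [hZ, covariance_fun_sub_left hX2 htY hY2, covariance_const_mul_left,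
      covariance_self hY2.aemeasurable, ← hβ, ← hγ, ht]
    field_simp
    ring
  have hind : IndepFun Z Y P := hZY.indepFun_of_covariance_eq_zero hcov
  have hZ0 : P[Z] = 0 := by
    rw [hZ]
    simp only
    rw [integral_sub (hX2.integrable one_le_two) (htY.integrable one_le_two), integral_const_mul,
      hX0, hY0]
    simp
  have hZv : Var[Z; P] = α - β ^ 2 / γ := by
    rw [hZ, variance_fun_sub hX2 htY, covariance_const_mul_right, variance_const_mul, ← hα, ← hγ,
      ← hβ, ht]
    field_simp
    ring
  have hτ : 0 ≤ α - β ^ 2 / γ := hZv ▸ variance_nonneg _ _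
  have hZl : P.map Z = gaussianReal 0 (α - β ^ 2 / γ).toNNReal := by
    rw [hZY.fst.map_eq_gaussianReal, hZ0, hZv]
  have hYl : P.map Y = gaussianReal 0 γ.toNNReal := by
    rw [hXY.snd.map_eq_gaussianReal, hY0]
  have hγ0 : γ.toNNReal ≠ 0 := by simpa using hY
  set γ' : NNReal := v * γ.toNNReal / (v + γ.toNNReal) with hγ'
  have hjoint : P.map (fun ω => (Z ω, Y ω)) =
      (gaussianReal 0 (α - β ^ 2 / γ).toNNReal).prod (gaussianReal 0 γ.toNNReal) := by
    rw [← hZl, ← hYl]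
    exact (indepFun_iff_map_prod_eq_prod_map_map hZY.fst.aemeasurable hXY.snd.aemeasurable).1 hind
  calc ∫⁻ ω, ENNReal.ofReal |X ω| * gaussianPDF 0 v (Y ω) ∂P
      = ∫⁻ ω, (fun q : ℝ × ℝ => ENNReal.ofReal |q.1 + t * q.2| * gaussianPDF 0 v q.2)
          (Z ω, Y ω) ∂P := by
        refine lintegral_congr fun ω => ?_
        simp [hZ]
    _ = ∫⁻ z, ∫⁻ y, ENNReal.ofReal |z + t * y| * gaussianPDF 0 v y
          ∂(gaussianReal 0 γ.toNNReal) ∂(gaussianReal 0 (α - β ^ 2 / γ).toNNReal) := by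
        rw [← lintegral_map' (f := fun q : ℝ × ℝ =>
            ENNReal.ofReal |q.1 + t * q.2| * gaussianPDF 0 v q.2)
          (Measurable.aemeasurable (by fun_prop)) hZY.aemeasurable, hjoint,
          lintegral_prod _ (Measurable.aemeasurable (by fun_prop))]
    _ = ENNReal.ofReal (√(2 * π * (v + γ)))⁻¹ * ∫⁻ z, ∫⁻ y, ENNReal.ofReal |z + t * y|
          ∂(gaussianReal 0 γ') ∂(gaussianReal 0 (α - β ^ 2 / γ).toNNReal) := by
        rw [← lintegral_const_mul _ (Measurable.lintegral_prod_right' (f := fun q : ℝ × ℝ =>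
          ENNReal.ofReal |q.1 + t * q.2|) (by fun_prop))]
        refine lintegral_congr fun z => ?_
        rw [lintegral_mul_gaussianPDF hv hγ0 (by fun_prop), Real.coe_toNNReal _ hY.le]
    _ = ENNReal.ofReal (√(2 * π * (v + γ)))⁻¹ *
          ENNReal.ofReal √(2 * ((α - β ^ 2 / γ) + t ^ 2 * (v * γ / (v + γ))) / π) := by
        congr 1
        have h1 : ∀ z : ℝ, ∫⁻ y, ENNReal.ofReal |z + t * y| ∂(gaussianReal 0 γ') =
            ∫⁻ y, ENNReal.ofReal |z + y| ∂((gaussianReal 0 γ').map (t * ·)) := fun z => by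
          rw [lintegral_map (by fun_prop) (by fun_prop)]
        simp_rw [h1]
        rw [gaussianReal_map_const_mul, ← Measure.lintegral_conv
          (f := fun w : ℝ => ENNReal.ofReal |w|) (by fun_prop),
          gaussianReal_conv_gaussianReal, mul_zero, add_zero, lintegral_abs_gaussianReal]
        congr 4
        simp [hγ', Real.coe_toNNReal _ hτ, Real.coe_toNNReal _ hY.le]
    _ = _ := by
        rw [← ENNReal.ofReal_mul (by positivity)]
        congr 1
        have hvγ : 0 < v + γ := by positivity
        rw [show 2 * ((α - β ^ 2 / γ) + t ^ 2 * (v * γ / (v + γ))) / π =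
            (α * (γ + v) - β ^ 2) * (2 * π * (v + γ)) / (π * (v + γ)) ^ 2 by
          rw [ht]; field_simp; ring,
          Real.sqrt_div' _ (by positivity), Real.sqrt_mul' (α * (γ + v) - β ^ 2) (by positivity),
          Real.sqrt_sq (by positivity), add_comm γ]
        have h2 : √(2 * π * (v + γ)) ≠ 0 := by positivity
        generalize √(2 * π * (v + γ)) = s at h2 ⊢
        generalize √(α * (v + γ) - β ^ 2) = r
        field_simp

/-! ### Zeros of Gaussian linear combinations -/

lemma covariance_sum_mul_sum_mul {Ω ι : Type*} [MeasurableSpace Ω] {P : Measure Ω}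
    [IsProbabilityMeasure P] [Fintype ι] {ξ : ι → Ω → ℝ} {v : NNReal}
    (hξ : ∀ i, HasLaw (ξ i) (gaussianReal 0 v) P) (hind : iIndepFun ξ P) (c d : ι → ℝ) :
    cov[fun ω => ∑ i, ξ i ω * c i, fun ω => ∑ i, ξ i ω * d i; P] = v * ∑ i, c i * d i := by
  classical
  have h2 : ∀ i, MemLp (ξ i) 2 P := fun i => (hξ i).hasGaussianLaw.memLp_two
  rw [covariance_fun_sum_fun_sum (fun i => (h2 i).mul_const _) (fun i => (h2 i).mul_const _)]
  simp_rw [covariance_mul_const_left, covariance_mul_const_right]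
  rw [Finset.mul_sum]
  refine Finset.sum_congr rfl fun i _ => ?_
  rw [Finset.sum_eq_single i]
  · rw [covariance_self (hξ i).aemeasurable, (hξ i).variance_eq, variance_id_gaussianReal]
    ring
  · intro j _ hj
    rw [(hind.indepFun hj.symm).covariance_eq_zero (h2 i) (h2 j)]
    ring
  · simp

lemma integral_sum_mul_eq_zero {Ω ι : Type*} [MeasurableSpace Ω] {P : Measure Ω}
    [IsProbabilityMeasure P] [Fintype ι] {ξ : ι → Ω → ℝ} {v : NNReal}
    (hξ : ∀ i, HasLaw (ξ i) (gaussianReal 0 v) P) (c : ι → ℝ) :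
    ∫ ω, ∑ i, ξ i ω * c i ∂P = 0 := by
  rw [integral_finsetSum _ fun i _ => (hξ i).hasGaussianLaw.integrable.mul_const _]
  refine Finset.sum_eq_zero fun i _ => ?_
  rw [integral_mul_const, (hξ i).integral_eq, integral_id_gaussianReal, zero_mul]

lemma hasGaussianLaw_sum_mul_prod {Ω ι : Type*} [MeasurableSpace Ω] {P : Measure Ω}
    [Fintype ι] {ξ : ι → Ω → ℝ} {v : NNReal}
    (hξ : ∀ i, HasLaw (ξ i) (gaussianReal 0 v) P) (hind : iIndepFun ξ P) (c d : ι → ℝ) :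
    HasGaussianLaw (fun ω => (∑ i, ξ i ω * c i, ∑ i, ξ i ω * d i)) P := by
  have h := (hind.hasGaussianLaw fun i => (hξ i).hasGaussianLaw).map_fun
    ((∑ i, c i • ContinuousLinearMap.proj (R := ℝ) (φ := fun _ : ι => ℝ) i).prod
      (∑ i, d i • ContinuousLinearMap.proj (R := ℝ) (φ := fun _ : ι => ℝ) i))
  refine h.congr (ae_of_all _ fun ω => ?_)
  simp [mul_comm]

open Real in
lemma lintegral_abs_sum_mul_gaussianPDF_sum {Ω ι : Type*} [MeasurableSpace Ω] {P : Measure Ω}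
    [IsProbabilityMeasure P] [Fintype ι] {ξ : ι → Ω → ℝ} {v : NNReal} (hv : v ≠ 0)
    (hξ : ∀ i, HasLaw (ξ i) (gaussianReal 0 v) P) (hind : iIndepFun ξ P) (c d : ι → ℝ)
    (hd : 0 < ∑ i, d i ^ 2) :
    ∫⁻ ω, ENNReal.ofReal |∑ i, ξ i ω * c i| * gaussianPDF 0 v (∑ i, ξ i ω * d i) ∂P =
      ENNReal.ofReal (1 / π * (√((∑ i, c i ^ 2) * (1 + ∑ i, d i ^ 2) - (∑ i, c i * d i) ^ 2)
        / (1 + ∑ i, d i ^ 2))) := by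
  have hv' : (0 : ℝ) < v := by positivity
  have hG := hasGaussianLaw_sum_mul_prod hξ hind c d
  have hvar : ∀ e : ι → ℝ, AEMeasurable (fun ω => ∑ i, ξ i ω * e i) P →
      Var[fun ω => ∑ i, ξ i ω * e i; P] = v * ∑ i, e i ^ 2 := fun e he => by
    rw [← covariance_self he, covariance_sum_mul_sum_mul hξ hind]
    simp_rw [sq]
  rw [lintegral_abs_mul_gaussianPDF hG (integral_sum_mul_eq_zero hξ c)
    (integral_sum_mul_eq_zero hξ d) (by rw [hvar _ hG.snd.aemeasurable]; positivity) hv,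
    hvar _ hG.snd.aemeasurable, hvar _ hG.fst.aemeasurable, covariance_sum_mul_sum_mul hξ hind]
  congr 2
  rw [show (v : ℝ) * (∑ i, c i ^ 2) * (v * ∑ i, d i ^ 2 + v) - (v * ∑ i, c i * d i) ^ 2 =
    v ^ 2 * ((∑ i, c i ^ 2) * (1 + ∑ i, d i ^ 2) - (∑ i, c i * d i) ^ 2) by ring,
    Real.sqrt_mul (by positivity), Real.sqrt_sq hv'.le]
  rw [show (v : ℝ) * ∑ i, d i ^ 2 + v = v * (1 + ∑ i, d i ^ 2) by ring,
    mul_div_mul_left _ _ hv'.ne']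

/-- The Kac-Rice formula for `a + ∑ i, ξ i * g i` with i.i.d. centred Gaussian `a` and `ξ i`. Given
the `ξ i`, the zeros are the solutions of `h x = a` with `h = -∑ i, ξ i * g i`, so their mean number
is given by the area formula; averaging over the `ξ i` is then a computation in the Gaussian plane
for each fixed `x`. -/
theorem lintegral_count_zeros_const_add {Ω ι : Type*} [MeasurableSpace Ω] {P : Measure Ω}
    [IsProbabilityMeasure P] [Fintype ι] {a : Ω → ℝ} {ξ : ι → Ω → ℝ} {v : NNReal} (hv : v ≠ 0)
    (ha : HasLaw a (gaussianReal 0 v) P) (hξ : ∀ i, HasLaw (ξ i) (gaussianReal 0 v) P)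
    (hind : iIndepFun ξ P) (hai : IndepFun (fun ω i => ξ i ω) a P)
    {U : Set ℝ} (hU : IsOpen U) {g g' : ι → ℝ → ℝ} (hg : ∀ i, Measurable (g i))
    (hg' : ∀ i, Measurable (g' i)) (hd : ∀ i, ∀ x ∈ U, HasDerivAt (g i) (g' i x) x)
    (hc : ∀ i, ContinuousOn (g' i) U) (hpos : ∀ x ∈ U, 0 < ∑ i, g i x ^ 2) :
    ∫⁻ ω, Measure.count (U ∩ {x | a ω + ∑ i, ξ i ω * g i x = 0}) ∂P =
      ∫⁻ x in U, ENNReal.ofReal (1 / Real.pi * (√((∑ i, g' i x ^ 2) * (1 + ∑ i, g i x ^ 2)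
        - (∑ i, g' i x * g i x) ^ 2) / (1 + ∑ i, g i x ^ 2))) := by
  have hξm : AEMeasurable (fun ω i => ξ i ω) P := aemeasurable_pi_lambda _ fun i =>
    (hξ i).aemeasurable
  set μ := P.map (fun ω i => ξ i ω) with hμ
  have : IsProbabilityMeasure μ := Measure.isProbabilityMeasure_map hξm
  have hjoint : P.map (fun ω => ((fun i => ξ i ω), a ω)) = μ.prod (gaussianReal 0 v) := by
    rw [← ha.map_eq]
    exact (indepFun_iff_map_prod_eq_prod_map_map hξm ha.aemeasurable).1 hai
  let F : (ι → ℝ) × ℝ → ℝ → ℝ := fun q x => q.2 + ∑ i, q.1 i * g i x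
  have hgc : ∀ i, ContinuousOn (g i) U := fun i x hx => (hd i x hx).continuousAt.continuousWithinAt
  have hFm : Measurable fun q => Measure.count (U ∩ F q ⁻¹' {0}) := by
    refine measurable_count_zeros hU (fun x _ => by fun_prop) fun q => ?_
    exact continuousOn_const.add (continuousOn_finsetSum _ fun i _ =>
      continuousOn_const.mul (hgc i))
  let h : (ι → ℝ) → ℝ → ℝ := fun w x => -∑ i, w i * g i x
  let h' : (ι → ℝ) → ℝ → ℝ := fun w x => -∑ i, w i * g' i x
  have hFh : ∀ w y, U ∩ F (w, y) ⁻¹' {0} = U ∩ h w ⁻¹' {y} := fun w y => by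
    ext x
    simp only [F, h, Set.mem_inter_iff, Set.mem_preimage, Set.mem_singleton_iff]
    refine and_congr_right fun _ => ⟨fun H => by linarith, fun H => by linarith⟩
  calc ∫⁻ ω, Measure.count (U ∩ {x | a ω + ∑ i, ξ i ω * g i x = 0}) ∂P
      = ∫⁻ w, ∫⁻ y, Measure.count (U ∩ F (w, y) ⁻¹' {0}) ∂(gaussianReal 0 v) ∂μ := by
        rw [← lintegral_prod _ hFm.aemeasurable, ← hjoint,
          lintegral_map' hFm.aemeasurable (hξm.prodMk ha.aemeasurable)]
        rfl
    _ = ∫⁻ w, (∫⁻ x in U, ENNReal.ofReal |h' w x| * gaussianPDF 0 v (h w x)) ∂μ := by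
        refine lintegral_congr fun w => ?_
        have hFw : Measurable fun y => Measure.count (U ∩ F (w, y) ⁻¹' {0}) :=
          hFm.comp measurable_prodMk_left
        rw [gaussianReal_of_var_ne_zero _ hv, lintegral_withDensity_eq_lintegral_mul _
          (by fun_prop) hFw]
        simp only [Pi.mul_apply, hFh, mul_comm (gaussianPDF 0 v _)]
        refine lintegral_count_preimage_mul hU (fun x hx => ?_) ?_ (by fun_prop)
        · exact (HasDerivAt.fun_sum fun i _ => (hd i x hx).const_mul (w i)).neg
        · exact (continuousOn_finsetSum _ fun i _ => continuousOn_const.mul (hc i)).neg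
    _ = ∫⁻ x in U, ∫⁻ w, ENNReal.ofReal |h' w x| * gaussianPDF 0 v (h w x) ∂μ := by
        refine lintegral_lintegral_swap (Measurable.aemeasurable ?_)
        dsimp only [h, h', Function.uncurry_def]
        fun_prop
    _ = _ := by
        refine setLIntegral_congr_fun hU.measurableSet fun x hx => ?_
        have hneg : ∀ (w : ι → ℝ) (e : ι → ℝ), -∑ i, w i * e i = ∑ i, w i * (-e i) :=
          fun w e => by simp
        have hm : Measurable fun w : ι → ℝ =>
            ENNReal.ofReal |h' w x| * gaussianPDF 0 v (h w x) := by
          dsimp only [h, h']; fun_prop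
        rw [hμ, lintegral_map' hm.aemeasurable hξm]
        dsimp only [h, h']
        simp only [hneg]
        rw [lintegral_abs_sum_mul_gaussianPDF_sum hv hξ hind _ _ (by simpa using hpos x hx)]
        simp

/-- The Kac-Rice formula for a random linear combination `∑ i, ξ i * Φ i` of smooth functions with
i.i.d. centred Gaussian coefficients, on an open set where one of the functions has no zero.
Dividing by that function, `Φ i₀`, makes its coefficient an additive constant; the quotient under
the integral does not change. -/
theorem lintegral_count_zeros_sum_mul {Ω ι : Type*} [MeasurableSpace Ω] {P : Measure Ω}
    [IsProbabilityMeasure P] [Fintype ι] [DecidableEq ι] {ξ : ι → Ω → ℝ} {v : NNReal} (hv : v ≠ 0)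
    (hξ : ∀ i, HasLaw (ξ i) (gaussianReal 0 v) P) (hind : iIndepFun ξ P)
    {U : Set ℝ} (hU : IsOpen U) {Φ Φ' : ι → ℝ → ℝ} (hd : ∀ i x, HasDerivAt (Φ i) (Φ' i x) x)
    (hc : ∀ i, Continuous (Φ' i)) {i₀ : ι} (h0 : ∀ x ∈ U, Φ i₀ x ≠ 0)
    (hpos : ∀ x ∈ U, Φ i₀ x ^ 2 < ∑ i, Φ i x ^ 2) :
    ∫⁻ ω, Measure.count (U ∩ {x | ∑ i, ξ i ω * Φ i x = 0}) ∂P =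
      ∫⁻ x in U, ENNReal.ofReal (1 / Real.pi * (√((∑ i, Φ' i x ^ 2) * (∑ i, Φ i x ^ 2)
        - (∑ i, Φ' i x * Φ i x) ^ 2) / (∑ i, Φ i x ^ 2))) := by
  let s : Finset ι := Finset.univ.erase i₀
  let ι' := {i // i ∈ s}
  have hΦc : ∀ i, Continuous (Φ i) := fun i =>
    continuous_iff_continuousAt.2 fun x => (hd i x).continuousAt
  let g : ι → ℝ → ℝ := fun i x => Φ i x / Φ i₀ x
  let g' : ι → ℝ → ℝ := fun i x => (Φ' i x * Φ i₀ x - Φ i x * Φ' i₀ x) / Φ i₀ x ^ 2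
  have hsum : ∀ f : ι → ℝ, ∑ i, f i = f i₀ + ∑ i : ι', f i := fun f => by
    rw [Finset.sum_coe_sort s f, Finset.add_sum_erase _ _ (Finset.mem_univ i₀)]
  have hg1 : ∀ x ∈ U, 1 + ∑ i : ι', g i x ^ 2 = (∑ i, Φ i x ^ 2) / Φ i₀ x ^ 2 := fun x hx => by
    have := hsum fun i => g i x ^ 2
    simp only [g, div_self (h0 x hx), one_pow] at this ⊢
    rw [← this, Finset.sum_div]
    exact Finset.sum_congr rfl fun i _ => by rw [div_pow]
  have hai : IndepFun (fun ω (i : ι') => ξ i ω) (ξ i₀) P := by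
    have := hind.indepFun_finset₀ s {i₀} (by simp [s]) fun i => (hξ i).aemeasurable
    exact this.comp measurable_id (measurable_pi_apply (⟨i₀, by simp⟩ : ({i₀} : Finset ι)))
  have hU' : ∀ ω, U ∩ {x | ∑ i, ξ i ω * Φ i x = 0} =
      U ∩ {x | ξ i₀ ω + ∑ i : ι', ξ i ω * g i x = 0} := fun ω => by
    ext x
    refine and_congr_right fun hx => ?_
    have h1 := hsum fun i => ξ i ω * g i x
    have h2 : (∑ i, ξ i ω * g i x) * Φ i₀ x = ∑ i, ξ i ω * Φ i x := by
      rw [Finset.sum_mul]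
      refine Finset.sum_congr rfl fun i _ => ?_
      simp only [g]
      field_simp [h0 x hx]
    simp only [g, div_self (h0 x hx), mul_one] at h1 h2 ⊢
    simp only [Set.mem_ofPred_eq]
    rw [← h1, ← h2]
    simp [h0 x hx]
  simp_rw [hU']
  rw [lintegral_count_zeros_const_add hv (hξ i₀) (fun i : ι' => hξ i)
    (hind.precomp Subtype.val_injective) hai hU (g := fun i : ι' => g i) (g' := fun i : ι' => g' i)]
  · refine setLIntegral_congr_fun hU.measurableSet fun x hx => ?_
    have hφ := h0 x hx
    have hS : 0 < ∑ i, Φ i x ^ 2 := (sq_nonneg _).trans_lt (hpos x hx)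
    have hg2 : ∑ i : ι', g' i x ^ 2 = (Φ i₀ x ^ 2 * (∑ i, Φ' i x ^ 2)
        - 2 * Φ i₀ x * Φ' i₀ x * (∑ i, Φ' i x * Φ i x)
        + Φ' i₀ x ^ 2 * (∑ i, Φ i x ^ 2)) / Φ i₀ x ^ 4 := by
      have := hsum fun i => g' i x ^ 2
      have h1 : g' i₀ x = 0 := by simp [g', mul_comm]
      rw [h1] at this
      rw [show ∑ i : ι', g' i x ^ 2 = ∑ i, g' i x ^ 2 by rw [this]; simp, Finset.mul_sum,
        Finset.mul_sum, Finset.mul_sum, ← Finset.sum_sub_distrib, ← Finset.sum_add_distrib,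
        Finset.sum_div]
      refine Finset.sum_congr rfl fun i _ => ?_
      simp only [g']
      field_simp
      ring
    have hg3 : ∑ i : ι', g' i x * g i x = (Φ i₀ x * (∑ i, Φ' i x * Φ i x)
        - Φ' i₀ x * (∑ i, Φ i x ^ 2)) / Φ i₀ x ^ 3 := by
      have := hsum fun i => g' i x * g i x
      have h1 : g' i₀ x = 0 := by simp [g', mul_comm]
      rw [h1] at this
      rw [show ∑ i : ι', g' i x * g i x = ∑ i, g' i x * g i x by rw [this]; simp, Finset.mul_sum,
        Finset.mul_sum, ← Finset.sum_sub_distrib, Finset.sum_div]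
      refine Finset.sum_congr rfl fun i _ => ?_
      simp only [g', g]
      field_simp
    rw [hg1 x hx, hg2, hg3]
    generalize ∑ i, Φ' i x * Φ i x = B
    generalize ∑ i, Φ' i x ^ 2 = D
    generalize ∑ i, Φ i x ^ 2 = S at hS
    generalize Φ i₀ x = φ at hφ
    generalize Φ' i₀ x = φ'
    congr 2
    rw [show (φ ^ 2 * D - 2 * φ * φ' * B + φ' ^ 2 * S) / φ ^ 4 * (S / φ ^ 2)
      - ((φ * B - φ' * S) / φ ^ 3) ^ 2 = (D * S - B ^ 2) / (φ ^ 2) ^ 2 by field_simp; ring,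
      Real.sqrt_div' _ (by positivity), Real.sqrt_sq (by positivity)]
    field_simp
  · exact fun i => (hΦc i).measurable.div (hΦc i₀).measurable
  · exact fun i => (((hc i).mul (hΦc i₀)).sub ((hΦc i).mul (hc i₀))).measurable.div
      ((hΦc i₀).pow 2).measurable
  · exact fun i x hx => (hd i x).div (hd i₀ x) (h0 x hx)
  · exact fun i => ContinuousOn.div
      (((hc i).mul (hΦc i₀)).sub ((hΦc i).mul (hc i₀))).continuousOn
      ((hΦc i₀).pow 2).continuousOn fun x hx => pow_ne_zero 2 (h0 x hx)
  · intro x hx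
    have h1 := hg1 x hx
    have h2 : 1 < (∑ i, Φ i x ^ 2) / Φ i₀ x ^ 2 := by
      have : 0 < Φ i₀ x ^ 2 := by have := h0 x hx; positivity
      rw [one_lt_div this]
      exact hpos x hx
    linarith

lemma aemeasurable_count_zeros_sum_mul {Ω ι : Type*} [MeasurableSpace Ω] {P : Measure Ω}
    [Fintype ι] {ξ : ι → Ω → ℝ} (hξ : ∀ i, AEMeasurable (ξ i) P) {U : Set ℝ} (hU : IsOpen U)
    {Φ : ι → ℝ → ℝ} (hc : ∀ i, Continuous (Φ i)) :
    AEMeasurable (fun ω => Measure.count (U ∩ {x | ∑ i, ξ i ω * Φ i x = 0})) P := by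
  have h : Measurable fun w : ι → ℝ =>
      Measure.count (U ∩ (fun x => ∑ i, w i * Φ i x) ⁻¹' {0}) :=
    measurable_count_zeros hU (fun x _ => by fun_prop) fun w => by fun_prop
  exact h.comp_aemeasurable (aemeasurable_pi_lambda _ hξ)

/-! ### Estimates for the density of zeros -/

/-- The density of zeros of a process with variance `N c² + M` differs little from that of the
stationary process, `√s`, as long as `N c²` is large. -/
lemma abs_zeroDensity_sub_sqrt_mul_le {N M S R c c' s n L : ℝ} (hN : 0 < N)
    (hM : M = 0 ∨ 1 ≤ M) (hv : 0 < N * c ^ 2 + M) (hR0 : 0 ≤ R) (hR : R ≤ M * n ^ 2)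
    (hS : S = N * s) (hs0 : 0 ≤ s) (hs : s ≤ n ^ 2) (hc' : c' ^ 2 ≤ L ^ 2) :
    |√((N * c' ^ 2 + (c ^ 2 * S + R)) * (N * c ^ 2 + M) - (N * (c' * c)) ^ 2) / (N * c ^ 2 + M)
      - √s| * √s ≤ M * (n ^ 2 + L ^ 2 * N) / (1 + N * c ^ 2) := by
  set u := N * c ^ 2 with hu
  have hu0 : 0 ≤ u := by positivity
  have hM0 : 0 ≤ M := by rcases hM with h | h <;> linarith
  have hgram : (N * c' ^ 2 + (c ^ 2 * S + R)) * (u + M) - (N * (c' * c)) ^ 2 =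
      N * M * c' ^ 2 + (u * s + R) * (u + M) := by rw [hu, hS]; ring
  rw [hgram]
  set ρ := √(N * M * c' ^ 2 + (u * s + R) * (u + M)) / (u + M) with hρ
  have hρ0 : 0 ≤ ρ := by positivity
  have hρ2 : ρ ^ 2 - s = (R - M * s) / (u + M) + M * N * c' ^ 2 / (u + M) ^ 2 := by
    rw [hρ, div_pow, Real.sq_sqrt (by positivity)]
    field_simp
    ring
  calc |ρ - √s| * √s ≤ |ρ - √s| * |ρ + √s| := by
        refine mul_le_mul_of_nonneg_left ?_ (abs_nonneg _)
        rw [abs_of_nonneg (by positivity)]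
        linarith
    _ = |ρ ^ 2 - s| := by
        rw [← abs_mul]
        congr 1
        linear_combination -Real.sq_sqrt hs0
    _ ≤ M * (n ^ 2 + L ^ 2 * N) / (1 + u) := by
        rw [hρ2]
        rcases hM with h | h
        · subst h
          have : R = 0 := by linarith
          simp [this]
        · have h1 : |(R - M * s) / (u + M)| ≤ M * n ^ 2 / (1 + u) := by
            rw [abs_div, abs_of_pos hv]
            have : |R - M * s| ≤ M * n ^ 2 := by
              have h3 : M * s ≤ M * n ^ 2 := mul_le_mul_of_nonneg_left hs hM0
              have h4 : 0 ≤ M * s := by positivity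
              rw [abs_le]
              constructor <;> linarith
            exact div_le_div₀ (by positivity) this (by positivity) (by linarith)
          have h2 : M * N * c' ^ 2 / (u + M) ^ 2 ≤ M * (L ^ 2 * N) / (1 + u) := by
            have h3 : 1 + u ≤ (u + M) ^ 2 := by nlinarith
            rw [show M * N * c' ^ 2 = M * (c' ^ 2 * N) by ring]
            gcongr
          have h5 : 0 ≤ M * N * c' ^ 2 / (u + M) ^ 2 := by positivity
          calc |(R - M * s) / (u + M) + M * N * c' ^ 2 / (u + M) ^ 2|
              ≤ |(R - M * s) / (u + M)| + M * N * c' ^ 2 / (u + M) ^ 2 := by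
                refine (abs_add_le _ _).trans ?_
                rw [abs_of_nonneg h5]
            _ ≤ M * n ^ 2 / (1 + u) + M * (L ^ 2 * N) / (1 + u) := add_le_add h1 h2
            _ = _ := by ring

open Real intervalIntegral in
lemma integral_inv_one_add_mul_cos_sq_le {ℓ : ℕ} (hℓ : 1 ≤ ℓ) {K : ℝ} (hK : 0 < K) :
    ∫ x in (0 : ℝ)..2 * π, 1 / (1 + K * cos (ℓ * x / 2) ^ 2) ≤ π ^ 2 / √K := by
  have hℓ' : (0 : ℝ) < ℓ := by exact_mod_cast hℓ
  have hper : Function.Periodic (fun t => 1 / (1 + K * cos t ^ 2)) π := fun t => by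
    simp [cos_add_pi]
  have hcont : Continuous fun t => 1 / (1 + K * cos t ^ 2) :=
    continuous_const.div (by fun_prop) fun t => by positivity
  have hint : ∀ a b, IntervalIntegrable (fun t => 1 / (1 + K * cos t ^ 2)) volume a b := fun a b =>
    hcont.intervalIntegrable a b
  have h1 : ∫ x in (0 : ℝ)..2 * π, 1 / (1 + K * cos (ℓ * x / 2) ^ 2)
      = 2 * ∫ t in (0 : ℝ)..π, 1 / (1 + K * cos t ^ 2) := by
    have hA : ∀ x : ℝ, (ℓ : ℝ) * x / 2 = ℓ / 2 * x := fun x => by ring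
    simp_rw [hA]
    rw [integral_comp_mul_left (fun t => 1 / (1 + K * cos t ^ 2)) (by positivity), mul_zero,
      show (ℓ : ℝ) / 2 * (2 * π) = 0 + (ℓ : ℤ) • π by simp; ring,
      hper.intervalIntegral_add_zsmul_eq _ _ hint]
    simp only [zero_add, zsmul_eq_mul, smul_eq_mul, Int.cast_natCast]
    field_simp
  have h2 : ∫ t in (0 : ℝ)..π, 1 / (1 + K * cos t ^ 2)
      = ∫ t in (-(π / 2))..(π / 2), 1 / (1 + K * sin t ^ 2) := by
    have := integral_comp_add_right (a := -(π / 2)) (b := π / 2)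
      (fun t => 1 / (1 + K * cos t ^ 2)) (π / 2)
    simp only [cos_add_pi_div_two, neg_sq, neg_add_cancel, add_halves] at this
    exact this.symm
  set b := 2 / π * √K with hb
  have hb0 : 0 < b := by positivity
  have h3 : ∫ t in (-(π / 2))..(π / 2), 1 / (1 + K * sin t ^ 2)
      ≤ ∫ t in (-(π / 2))..(π / 2), 1 / (1 + (b * t) ^ 2) := by
    refine integral_mono_on (by linarith [pi_pos]) ?_ ?_ fun t ht => ?_
    · exact (continuous_const.div (by fun_prop) fun t => by positivity).intervalIntegrable _ _
    · exact (continuous_const.div (by fun_prop) fun t => by positivity).intervalIntegrable _ _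
    · have h4 : 2 / π * |t| ≤ |sin t| := mul_abs_le_abs_sin (abs_le.2 ⟨ht.1, ht.2⟩)
      have h5 : (2 / π * |t|) ^ 2 ≤ sin t ^ 2 := by
        rw [← sq_abs (sin t)]
        exact pow_le_pow_left₀ (by positivity) h4 2
      have h6 : (b * t) ^ 2 = K * (2 / π * |t|) ^ 2 := by
        rw [hb, mul_pow, mul_pow, mul_pow, sq_abs, sq_sqrt hK.le]
        ring
      rw [h6]
      gcongr
  have h4 : ∫ t in (-(π / 2))..(π / 2), 1 / (1 + (b * t) ^ 2) ≤ π / b := by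
    rw [integral_comp_mul_left (fun t => 1 / (1 + t ^ 2)) hb0.ne', integral_one_div_one_add_sq,
      smul_eq_mul, inv_mul_eq_div]
    gcongr
    linarith [arctan_lt_pi_div_two (b * (π / 2)), neg_pi_div_two_lt_arctan (b * -(π / 2))]
  rw [h1, h2]
  calc 2 * ∫ t in (-(π / 2))..(π / 2), 1 / (1 + K * sin t ^ 2) ≤ 2 * (π / b) := by linarith
    _ = π ^ 2 / √K := by rw [hb]; field_simp

lemma sum_range_sq_cast (m : ℕ) :
    ∑ j ∈ Finset.range m, (j : ℝ) ^ 2 = m * (m - 1) * (2 * m - 1) / 6 := by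
  induction m with
  | zero => simp
  | succ k ih => rw [Finset.sum_range_succ, ih]; push_cast; ring

/-- The mean square of the frequencies `2 ℓ j + k + ℓ / 2` is `(2 ℓ m)² / 3` up to a linear term. -/
lemma abs_mean_sq_frequency_sub_le {ℓ m : ℕ} (hℓ : 1 ≤ ℓ) (hm : 1 ≤ m) {s : ℝ}
    (hs : ∑ j : Fin m, ∑ k : Fin ℓ, ((ℓ : ℝ) * (2 * j) + k + ℓ / 2) ^ 2 = m * ℓ * s) :
    |s - (2 * ℓ * m) ^ 2 / 3| ≤ 2 * (ℓ : ℝ) * (2 * ℓ * m) := by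
  have hℓ' : (1 : ℝ) ≤ ℓ := by exact_mod_cast hℓ
  have hm' : (1 : ℝ) ≤ m := by exact_mod_cast hm
  have hk : ∀ k : Fin ℓ, (k : ℝ) ≤ ℓ := fun k => by exact_mod_cast k.2.le
  have hlow : m * ℓ * s ≥ ∑ j : Fin m, ∑ k : Fin ℓ, ((ℓ : ℝ) * (2 * j)) ^ 2 := by
    rw [← hs]
    refine Finset.sum_le_sum fun j _ => Finset.sum_le_sum fun k _ => ?_
    gcongr
    have : (0 : ℝ) ≤ k := by positivity
    linarith
  have hupp : m * ℓ * s ≤ ∑ j : Fin m, ∑ k : Fin ℓ, ((ℓ : ℝ) * (2 * j) + 2 * ℓ) ^ 2 := by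
    rw [← hs]
    refine Finset.sum_le_sum fun j _ => Finset.sum_le_sum fun k _ => ?_
    gcongr ?_ ^ 2
    linarith [hk k]
  have e1 : ∑ j : Fin m, ∑ k : Fin ℓ, ((ℓ : ℝ) * (2 * j)) ^ 2
      = (m : ℝ) * ℓ * (4 * ℓ ^ 2 * ((m - 1) * (2 * m - 1) / 6)) := by
    simp only [Finset.sum_const, Finset.card_univ, Fintype.card_fin, nsmul_eq_mul]
    rw [← Finset.mul_sum, Fin.sum_univ_eq_sum_range (fun j => ((ℓ : ℝ) * (2 * j)) ^ 2) m]
    simp_rw [mul_pow]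
    rw [← Finset.mul_sum, ← Finset.mul_sum, sum_range_sq_cast]
    ring
  have e2 : ∑ j : Fin m, ∑ k : Fin ℓ, ((ℓ : ℝ) * (2 * j) + 2 * ℓ) ^ 2
      = (m : ℝ) * ℓ * (4 * ℓ ^ 2 * ((m + 1) * (2 * m + 1) / 6)) := by
    simp only [Finset.sum_const, Finset.card_univ, Fintype.card_fin, nsmul_eq_mul]
    rw [← Finset.mul_sum, Fin.sum_univ_eq_sum_range (fun j => ((ℓ : ℝ) * (2 * j) + 2 * ℓ) ^ 2) m]
    have h1 := sum_range_sq_cast (m + 1)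
    rw [Finset.sum_range_succ'] at h1
    have h2 : ∀ j : ℕ, ((ℓ : ℝ) * (2 * j) + 2 * ℓ) ^ 2 = 4 * ℓ ^ 2 * ((j + 1 : ℕ) : ℝ) ^ 2 :=
      fun j => by push_cast; ring
    simp_rw [h2]
    rw [← Finset.mul_sum]
    push_cast at h1 ⊢
    have h3 : ∑ j ∈ Finset.range m, ((j : ℝ) + 1) ^ 2 = (m : ℝ) * (m + 1) * (2 * m + 1) / 6 := by
      linarith
    rw [h3]
    ring
  have hpos : (0 : ℝ) < m * ℓ := by positivity
  rw [e1] at hlow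
  rw [e2] at hupp
  have h1 := le_of_mul_le_mul_left hlow hpos
  have h2 := le_of_mul_le_mul_left hupp hpos
  have h3 : (ℓ : ℝ) ^ 2 ≤ ℓ ^ 2 * m := le_mul_of_one_le_right (by positivity) hm'
  rw [abs_le]
  constructor <;> nlinarith [sq_nonneg (ℓ : ℝ)]

lemma abs_sqrt_sub_div_sqrt_three_le {s q n L : ℝ} (hq : 0 < q) (hL : 0 ≤ L)
    (hs : |s - q ^ 2 / 3| ≤ 2 * L * q) (hs0 : 0 ≤ s) (hqn : |q - n| ≤ 2 * L) :
    |√s - n / √3| ≤ 6 * L := by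
  have h3 : (0 : ℝ) < √3 := by positivity
  have h33 : √3 ^ 2 = (3 : ℝ) := Real.sq_sqrt (by norm_num)
  have h3l : √3 ≤ (2 : ℝ) := by nlinarith
  have h3l' : (1 : ℝ) ≤ √3 := by nlinarith
  have h1 : |√s - q / √3| * (q / √3) ≤ 2 * L * q := by
    calc |√s - q / √3| * (q / √3) ≤ |√s - q / √3| * |√s + q / √3| := by
          refine mul_le_mul_of_nonneg_left ?_ (abs_nonneg _)
          rw [abs_of_nonneg (by positivity)]
          linarith [Real.sqrt_nonneg s]
      _ = |s - q ^ 2 / 3| := by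
          rw [← abs_mul]
          congr 1
          have : (q / √3) ^ 2 = q ^ 2 / 3 := by rw [div_pow, h33]
          linear_combination Real.sq_sqrt hs0 - this
      _ ≤ _ := hs
  have h2 : |√s - q / √3| ≤ 4 * L := by
    have h4 : |√s - q / √3| * (q / √3) = |√s - q / √3| / √3 * q := by ring
    rw [h4] at h1
    have h5 := le_of_mul_le_mul_right h1 hq
    rw [div_le_iff₀ h3] at h5
    nlinarith
  have h4 : |q / √3 - n / √3| ≤ 2 * L := by
    rw [← sub_div, abs_div, abs_of_pos h3, div_le_iff₀ h3]
    nlinarith [abs_nonneg (q - n)]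
  calc |√s - n / √3| ≤ |√s - q / √3| + |q / √3 - n / √3| := abs_sub_le _ _ _
    _ ≤ 6 * L := by linarith

/-! ### Reduction to independent coefficients -/

/-- Labels of the free coefficients of one kind: `k`-th entry of the `j`-th pair of blocks, or
`t`-th entry of the remainder. -/
abbrev FreeLabel (ℓ m M : ℕ) : Type := (Fin m × Fin ℓ) ⊕ Fin M

/-- The position of a free coefficient among `0, …, n`. -/
def freePos (ℓ m M : ℕ) : FreeLabel ℓ m M → ℕ :=
  Sum.elim (fun q => ℓ * (2 * q.1) + q.2) fun t => 2 * ℓ * m + t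

lemma freePos_injective (ℓ m M : ℕ) : Function.Injective (freePos ℓ m M) := by
  have hlt : ∀ (j : Fin m) (k : Fin ℓ), ℓ * (2 * j) + k < 2 * ℓ * m := fun j k => by
    have h1 : (j : ℕ) + 1 ≤ m := j.2
    have h2 : 2 * ℓ * ((j : ℕ) + 1) ≤ 2 * ℓ * m := Nat.mul_le_mul_left _ h1
    have h3 := k.2
    nlinarith
  rintro (⟨j, k⟩ | t) (⟨j', k'⟩ | t') h
  · simp only [freePos, Sum.elim_inl] at h
    have hℓ : 0 < ℓ := k.pos
    have h1 := congrArg (· / ℓ) h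
    have h2 := congrArg (· % ℓ) h
    simp only [Nat.mul_add_div hℓ, Nat.mul_add_mod, Nat.div_eq_of_lt k.2, Nat.div_eq_of_lt k'.2,
      Nat.mod_eq_of_lt k.2, Nat.mod_eq_of_lt k'.2] at h1 h2
    have h3 : j = j' := Fin.ext (by omega)
    have h4 : k = k' := Fin.ext h2
    rw [h3, h4]
  · simp only [freePos, Sum.elim_inl, Sum.elim_inr] at h
    have := hlt j k
    omega
  · simp only [freePos, Sum.elim_inl, Sum.elim_inr] at h
    have := hlt j' k'
    omega
  · simp only [freePos, Sum.elim_inr] at h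
    have h3 : t = t' := Fin.ext (by omega)
    rw [h3]

lemma freePos_mem_freeIndices {ℓ m M n : ℕ} (hn : n + 1 = 2 * ℓ * m + M) (κ : FreeLabel ℓ m M) :
    freePos ℓ m M κ ∈ freeIndices ℓ m n := by
  rcases κ with ⟨j, k⟩ | t
  · exact Or.inl ⟨j, j.2, k, k.2, rfl⟩
  · refine Or.inr ⟨?_, ?_⟩
    · simp [freePos]
    · have := t.2
      simp only [freePos, Sum.elim_inr]
      omega

lemma sum_range_eq_sum_pairs_add {R : Type*} [AddCommMonoid R] (ℓ m M : ℕ) (f : ℕ → R) :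
    ∑ i ∈ Finset.range (2 * ℓ * m + M), f i =
      ∑ j : Fin m, ∑ k : Fin ℓ, (f (ℓ * (2 * j) + k) + f (ℓ * (2 * j + 1) + k))
        + ∑ t : Fin M, f (2 * ℓ * m + t) := by
  rw [Finset.sum_range_add, Finset.sum_range (fun t => f (2 * ℓ * m + t))]
  congr 1
  rw [Fin.sum_univ_eq_sum_range
    (fun j => ∑ k : Fin ℓ, (f (ℓ * (2 * j) + k) + f (ℓ * (2 * j + 1) + k))) m]
  induction m with
  | zero => simp
  | succ p ih =>
    rw [Finset.sum_range_succ, ← ih, show 2 * ℓ * (p + 1) = 2 * ℓ * p + ℓ + ℓ by ring,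
      Finset.sum_range_add, Finset.sum_range_add, Finset.sum_add_distrib, add_assoc,
      show ℓ * (2 * p) = 2 * ℓ * p by ring, show ℓ * (2 * p + 1) = 2 * ℓ * p + ℓ by ring]
    simp only [Finset.sum_range]

/-- The amplitude with which a free coefficient enters the polynomial: two equal coefficients at
distance `ℓ` combine by the sum-to-product formula, which gives the factor `2 cos (ℓ x / 2)`. -/
noncomputable def amplitude (ℓ m M : ℕ) : FreeLabel ℓ m M → ℝ → ℝ :=
  Sum.elim (fun _ x => 2 * Real.cos (ℓ * x / 2)) fun _ _ => 1

/-- The derivative of `amplitude`. -/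
noncomputable def amplitudeDeriv (ℓ m M : ℕ) : FreeLabel ℓ m M → ℝ → ℝ :=
  Sum.elim (fun _ x => -(ℓ * Real.sin (ℓ * x / 2))) fun _ _ => 0

/-- The frequency belonging to a free coefficient: for a pair of equal coefficients the mean of the
two frequencies. -/
noncomputable def frequency (ℓ m M : ℕ) : FreeLabel ℓ m M → ℝ :=
  Sum.elim (fun q => ℓ * (2 * q.1) + q.2 + ℓ / 2) fun t => 2 * ℓ * m + t

/-- The functions multiplied by the free coefficients, cosine ones first. -/
noncomputable def waveform (ℓ m M : ℕ) : FreeLabel ℓ m M ⊕ FreeLabel ℓ m M → ℝ → ℝ :=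
  Sum.elim (fun κ x => amplitude ℓ m M κ x * Real.cos (frequency ℓ m M κ * x))
    fun κ x => amplitude ℓ m M κ x * Real.sin (frequency ℓ m M κ * x)

/-- The derivative of `waveform`. -/
noncomputable def waveformDeriv (ℓ m M : ℕ) : FreeLabel ℓ m M ⊕ FreeLabel ℓ m M → ℝ → ℝ :=
  Sum.elim (fun κ x => amplitudeDeriv ℓ m M κ x * Real.cos (frequency ℓ m M κ * x)
      - amplitude ℓ m M κ x * (frequency ℓ m M κ * Real.sin (frequency ℓ m M κ * x)))
    fun κ x => amplitudeDeriv ℓ m M κ x * Real.sin (frequency ℓ m M κ * x)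
      + amplitude ℓ m M κ x * (frequency ℓ m M κ * Real.cos (frequency ℓ m M κ * x))

lemma hasDerivAt_amplitude (ℓ m M : ℕ) (κ : FreeLabel ℓ m M) (x : ℝ) :
    HasDerivAt (amplitude ℓ m M κ) (amplitudeDeriv ℓ m M κ x) x := by
  rcases κ with q | t
  · have h : HasDerivAt (fun x : ℝ => (ℓ : ℝ) * x / 2) (ℓ / 2) x := by
      simpa using ((hasDerivAt_id x).const_mul (ℓ : ℝ)).div_const 2
    convert! h.cos.const_mul 2 using 1
    simp only [amplitudeDeriv, Sum.elim_inl]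
    ring
  · exact hasDerivAt_const x 1

lemma hasDerivAt_waveform (ℓ m M : ℕ) (i : FreeLabel ℓ m M ⊕ FreeLabel ℓ m M) (x : ℝ) :
    HasDerivAt (waveform ℓ m M i) (waveformDeriv ℓ m M i x) x := by
  have h : ∀ c : ℝ, HasDerivAt (fun x : ℝ => c * x) c x := fun c => by
    simpa using (hasDerivAt_id x).const_mul c
  rcases i with κ | κ
  · convert! (hasDerivAt_amplitude ℓ m M κ x).mul (h (frequency ℓ m M κ)).cos using 1
    simp only [waveformDeriv, Sum.elim_inl]
    ring
  · convert! (hasDerivAt_amplitude ℓ m M κ x).mul (h (frequency ℓ m M κ)).sin using 1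
    simp only [waveformDeriv, Sum.elim_inr]
    ring

lemma continuous_waveformDeriv (ℓ m M : ℕ) (i : FreeLabel ℓ m M ⊕ FreeLabel ℓ m M) :
    Continuous (waveformDeriv ℓ m M i) := by
  have h : ∀ κ, Continuous (amplitude ℓ m M κ) := fun κ =>
    continuous_iff_continuousAt.2 fun x => (hasDerivAt_amplitude ℓ m M κ x).continuousAt
  have h' : ∀ κ, Continuous (amplitudeDeriv ℓ m M κ) := by
    rintro (q | t)
    · simp only [amplitudeDeriv, Sum.elim_inl]
      fun_prop
    · exact continuous_const
  rcases i with κ | κ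
  · have h1 := h κ
    have h2 := h' κ
    simp only [waveformDeriv, Sum.elim_inl]
    fun_prop
  · have h1 := h κ
    have h2 := h' κ
    simp only [waveformDeriv, Sum.elim_inr]
    fun_prop

lemma sum_waveform_sq (ℓ m M : ℕ) (x : ℝ) :
    ∑ i, waveform ℓ m M i x ^ 2 = m * ℓ * (2 * Real.cos (ℓ * x / 2)) ^ 2 + M := by
  simp only [waveform, Fintype.sum_sum_type (α₁ := FreeLabel ℓ m M), Sum.elim_inl, Sum.elim_inr]
  rw [← Finset.sum_add_distrib]
  have : ∀ κ, (amplitude ℓ m M κ x * Real.cos (frequency ℓ m M κ * x)) ^ 2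
      + (amplitude ℓ m M κ x * Real.sin (frequency ℓ m M κ * x)) ^ 2 = amplitude ℓ m M κ x ^ 2 :=
    fun κ => by
      linear_combination amplitude ℓ m M κ x ^ 2 * Real.sin_sq_add_cos_sq (frequency ℓ m M κ * x)
  rw [Finset.sum_congr rfl fun κ _ => this κ, Fintype.sum_sum_type]
  simp [amplitude]

lemma sum_waveformDeriv_mul_waveform (ℓ m M : ℕ) (x : ℝ) :
    ∑ i, waveformDeriv ℓ m M i x * waveform ℓ m M i x =
      m * ℓ * (-(ℓ * Real.sin (ℓ * x / 2)) * (2 * Real.cos (ℓ * x / 2))) := by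
  simp only [waveform, waveformDeriv, Fintype.sum_sum_type (α₁ := FreeLabel ℓ m M), Sum.elim_inl,
    Sum.elim_inr]
  rw [← Finset.sum_add_distrib]
  have : ∀ κ, (amplitudeDeriv ℓ m M κ x * Real.cos (frequency ℓ m M κ * x)
      - amplitude ℓ m M κ x * (frequency ℓ m M κ * Real.sin (frequency ℓ m M κ * x))) *
        (amplitude ℓ m M κ x * Real.cos (frequency ℓ m M κ * x))
      + (amplitudeDeriv ℓ m M κ x * Real.sin (frequency ℓ m M κ * x)
      + amplitude ℓ m M κ x * (frequency ℓ m M κ * Real.cos (frequency ℓ m M κ * x))) *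
        (amplitude ℓ m M κ x * Real.sin (frequency ℓ m M κ * x))
      = amplitudeDeriv ℓ m M κ x * amplitude ℓ m M κ x :=
    fun κ => by
      linear_combination amplitudeDeriv ℓ m M κ x * amplitude ℓ m M κ x *
        Real.sin_sq_add_cos_sq (frequency ℓ m M κ * x)
  rw [Finset.sum_congr rfl fun κ _ => this κ, Fintype.sum_sum_type]
  simp [amplitude, amplitudeDeriv]

lemma sum_waveformDeriv_sq (ℓ m M : ℕ) (x : ℝ) :
    ∑ i, waveformDeriv ℓ m M i x ^ 2 = m * ℓ * (-(ℓ * Real.sin (ℓ * x / 2))) ^ 2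
      + ((2 * Real.cos (ℓ * x / 2)) ^ 2
          * (∑ j : Fin m, ∑ k : Fin ℓ, ((ℓ : ℝ) * (2 * j) + k + ℓ / 2) ^ 2)
        + ∑ t : Fin M, ((2 : ℝ) * ℓ * m + t) ^ 2) := by
  simp only [waveformDeriv, Fintype.sum_sum_type (α₁ := FreeLabel ℓ m M), Sum.elim_inl,
    Sum.elim_inr]
  rw [← Finset.sum_add_distrib]
  have : ∀ κ, (amplitudeDeriv ℓ m M κ x * Real.cos (frequency ℓ m M κ * x)
      - amplitude ℓ m M κ x * (frequency ℓ m M κ * Real.sin (frequency ℓ m M κ * x))) ^ 2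
      + (amplitudeDeriv ℓ m M κ x * Real.sin (frequency ℓ m M κ * x)
      + amplitude ℓ m M κ x * (frequency ℓ m M κ * Real.cos (frequency ℓ m M κ * x))) ^ 2
      = amplitudeDeriv ℓ m M κ x ^ 2 + amplitude ℓ m M κ x ^ 2 * frequency ℓ m M κ ^ 2 :=
    fun κ => by
      linear_combination (amplitudeDeriv ℓ m M κ x ^ 2
        + amplitude ℓ m M κ x ^ 2 * frequency ℓ m M κ ^ 2) *
        Real.sin_sq_add_cos_sq (frequency ℓ m M κ * x)
  rw [Finset.sum_congr rfl fun κ _ => this κ, Fintype.sum_sum_type, Fintype.sum_prod_type]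
  simp only [amplitude, amplitudeDeriv, frequency, Sum.elim_inl, Sum.elim_inr,
    Finset.sum_add_distrib, ← Finset.mul_sum, Finset.sum_const, Finset.card_univ, Fintype.card_fin,
    nsmul_eq_mul]
  ring

/-- If consecutive blocks are equal, the polynomial is a combination of the waveforms. -/
lemma trigPoly_eq_sum_waveform {ℓ m M n : ℕ} (hn : n + 1 = 2 * ℓ * m + M) {a b : ℕ → ℝ}
    (ha : ∀ j < m, ∀ k < ℓ, a (ℓ * (2 * j) + k) = a (ℓ * (2 * j + 1) + k))
    (hb : ∀ j < m, ∀ k < ℓ, b (ℓ * (2 * j) + k) = b (ℓ * (2 * j + 1) + k)) (x : ℝ) :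
    trigPoly n a b x = ∑ i, Sum.elim (fun κ => a (freePos ℓ m M κ))
      (fun κ => b (freePos ℓ m M κ)) i * waveform ℓ m M i x := by
  rw [trigPoly, hn, sum_range_eq_sum_pairs_add, Fintype.sum_sum_type, ← Finset.sum_add_distrib,
    Fintype.sum_sum_type, Fintype.sum_prod_type]
  congr 1
  · refine Finset.sum_congr rfl fun j _ => Finset.sum_congr rfl fun k _ => ?_
    simp only [waveform, amplitude, frequency, freePos, Sum.elim_inl, Sum.elim_inr]
    rw [← ha j j.2 k k.2, ← hb j j.2 k k.2]
    push_cast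
    set y := ((ℓ : ℝ) * (2 * j) + k + ℓ / 2) * x with hy
    rw [show ((ℓ : ℝ) * (2 * j) + k) * x = y - ℓ * x / 2 by rw [hy]; ring,
      show ((ℓ : ℝ) * (2 * j + 1) + k) * x = y + ℓ * x / 2 by rw [hy]; ring,
      Real.cos_add, Real.cos_sub, Real.sin_add, Real.sin_sub]
    ring
  · refine Finset.sum_congr rfl fun t _ => ?_
    simp only [waveform, amplitude, frequency, freePos, Sum.elim_inl, Sum.elim_inr]
    push_cast
    ring

/-! ### The mean number of zeros -/

/-- The density of zeros, up to the factor `1 / π`: the rate in the Kac-Rice formula for the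
waveforms. -/
noncomputable def zeroDensity (ℓ m M : ℕ) (x : ℝ) : ℝ :=
  √((∑ i, waveformDeriv ℓ m M i x ^ 2) * (∑ i, waveform ℓ m M i x ^ 2)
    - (∑ i, waveformDeriv ℓ m M i x * waveform ℓ m M i x) ^ 2) / (∑ i, waveform ℓ m M i x ^ 2)

/-- The points of `(0, 2π)` where the common factor `2 cos (ℓ x / 2)` of the paired terms does not
vanish. -/
def regularPoints (ℓ : ℕ) : Set ℝ :=
  {x | x ∈ Set.Ioo 0 (2 * Real.pi) ∧ Real.cos (ℓ * x / 2) ≠ 0}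

/-- The points of `(0, 2π)` where the common factor `2 cos (ℓ x / 2)` of the paired terms
vanishes. If there is no remainder these are zeros of the polynomial for all coefficients. -/
def singularPoints (ℓ : ℕ) : Set ℝ :=
  {x | x ∈ Set.Ioo 0 (2 * Real.pi) ∧ Real.cos (ℓ * x / 2) = 0}

lemma isOpen_regularPoints (ℓ : ℕ) : IsOpen (regularPoints ℓ) :=
  isOpen_Ioo.inter (isOpen_ne_fun (by fun_prop) continuous_const)

lemma regularPoints_union_singularPoints (ℓ : ℕ) :
    regularPoints ℓ ∪ singularPoints ℓ = Set.Ioo 0 (2 * Real.pi) := by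
  ext x
  simp only [regularPoints, singularPoints, Set.mem_union, Set.mem_ofPred_eq]
  tauto

lemma finite_singularPoints {ℓ : ℕ} (hℓ : 1 ≤ ℓ) : (singularPoints ℓ).Finite := by
  have hℓ' : (0 : ℝ) < ℓ := by exact_mod_cast hℓ
  refine ((Set.finite_Icc (0 : ℤ) ℓ).image fun k : ℤ => (2 * k + 1) * Real.pi / ℓ).subset ?_
  rintro x ⟨⟨hx0, hx1⟩, hx⟩
  obtain ⟨k, hk⟩ := Real.cos_eq_zero_iff.1 hx
  have hxk : x = (2 * k + 1) * Real.pi / ℓ := by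
    field_simp
    linarith
  refine ⟨k, ⟨?_, ?_⟩, hxk.symm⟩
  · have h1 : 0 < (2 * (k : ℝ) + 1) * Real.pi := by
      rw [← div_pos_iff_of_pos_right hℓ', ← hxk]
      exact hx0
    have h2 : 0 < 2 * (k : ℝ) + 1 := pos_of_mul_pos_left h1 Real.pi_pos.le
    have h3 : 0 < 2 * k + 1 := by exact_mod_cast h2
    omega
  · rw [hxk, div_lt_iff₀ hℓ'] at hx1
    have h2 : 2 * (k : ℝ) + 1 < 2 * ℓ := by
      refine lt_of_mul_lt_mul_right ?_ Real.pi_pos.le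
      linarith
    have h3 : 2 * k + 1 < 2 * (ℓ : ℤ) := by exact_mod_cast h2
    omega

lemma regularPoints_ae_eq {ℓ : ℕ} (hℓ : 1 ≤ ℓ) :
    (regularPoints ℓ : Set ℝ) =ᵐ[volume] Set.Ioo 0 (2 * Real.pi) := by
  rw [← regularPoints_union_singularPoints ℓ]
  exact (union_ae_eq_left_of_ae_eq_empty
    (ae_eq_empty.2 ((finite_singularPoints hℓ).measure_zero volume))).symm

lemma measurable_zeroDensity (ℓ m M : ℕ) : Measurable (zeroDensity ℓ m M) := by
  have h1 : ∀ i, Measurable (waveform ℓ m M i) := fun i => (continuous_iff_continuousAt.2 fun x =>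
    (hasDerivAt_waveform ℓ m M i x).continuousAt).measurable
  have h2 : ∀ i, Measurable (waveformDeriv ℓ m M i) := fun i =>
    (continuous_waveformDeriv ℓ m M i).measurable
  unfold zeroDensity
  fun_prop

/-- Where the paired terms dominate, `zeroDensity` is close to a constant `S`, the root mean square
of the paired frequencies, and `S` is `n / √3` up to a bounded error. -/
lemma exists_abs_zeroDensity_sub_le {ℓ m M n : ℕ} (hℓ : 1 ≤ ℓ) (hM : M < 2 * ℓ)
    (hn : n + 1 = 2 * ℓ * m + M) (hn0 : 20 * ℓ ≤ n) :
    ∃ S : ℝ, |S - n / √3| ≤ 6 * ℓ ∧ ∀ x ∈ regularPoints ℓ, |zeroDensity ℓ m M x - S| ≤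
      8 * ℓ * (1 + ℓ ^ 2) * n * (1 / (1 + 4 * (m * ℓ) * Real.cos (ℓ * x / 2) ^ 2)) := by
  have hm : 1 ≤ m := by
    by_contra h
    have : m = 0 := by omega
    subst this
    omega
  have hℓ' : (1 : ℝ) ≤ ℓ := by exact_mod_cast hℓ
  have hm' : (1 : ℝ) ≤ m := by exact_mod_cast hm
  have hn' : (n : ℝ) + 1 = 2 * ℓ * m + M := by exact_mod_cast hn
  have hn0' : 20 * (ℓ : ℝ) ≤ n := by exact_mod_cast hn0
  have hM' : (M : ℝ) + 1 ≤ 2 * ℓ := by exact_mod_cast hM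
  have hM0 : (0 : ℝ) ≤ M := by positivity
  have hN : (0 : ℝ) < m * ℓ := by positivity
  set Q := ∑ j : Fin m, ∑ k : Fin ℓ, ((ℓ : ℝ) * (2 * j) + k + ℓ / 2) ^ 2 with hQ
  set s := Q / (m * ℓ) with hs
  have hQs : Q = m * ℓ * s := by rw [hs]; field_simp
  have hs0 : 0 ≤ s := div_nonneg
    (Finset.sum_nonneg fun _ _ => Finset.sum_nonneg fun _ _ => sq_nonneg _) hN.le
  have hs3 := abs_mean_sq_frequency_sub_le hℓ hm hQs
  have hS := abs_sqrt_sub_div_sqrt_three_le (q := 2 * ℓ * m) (n := n) (L := ℓ) (by positivity)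
    (by positivity) hs3 hs0 (by rw [abs_le]; constructor <;> linarith)
  have hsn : s ≤ (n : ℝ) ^ 2 := by
    have h1 := (abs_le.1 hs3).2
    have hq : 2 * (ℓ : ℝ) * m ≤ n + 1 := by linarith
    have hq0 : 0 ≤ 2 * (ℓ : ℝ) * m := by positivity
    nlinarith
  -- this is where `20 ℓ ≤ n` matters: `1 / √3 - 6 / 20` exceeds `1 / 4`
  have hSn : (n : ℝ) / 4 ≤ √s := by
    have h1 := (abs_le.1 hS).1
    have h3 : √3 ≤ (7 / 4 : ℝ) := by
      rw [Real.sqrt_le_left (by norm_num)]; norm_num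
    have h4 : (n : ℝ) * (4 / 7) ≤ n / √3 := by
      rw [le_div_iff₀ (by positivity)]
      nlinarith [Real.sqrt_nonneg 3, mul_nonneg (Nat.cast_nonneg (α := ℝ) n) (sub_nonneg.2 h3)]
    linarith
  refine ⟨√s, hS, fun x hx => ?_⟩
  have hR : ∑ t : Fin M, ((2 : ℝ) * ℓ * m + t) ^ 2 ≤ M * (n : ℝ) ^ 2 := by
    calc ∑ t : Fin M, ((2 : ℝ) * ℓ * m + t) ^ 2 ≤ ∑ _t : Fin M, (n : ℝ) ^ 2 := by
          refine Finset.sum_le_sum fun t _ => ?_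
          have : ((t : ℕ) : ℝ) + 1 ≤ M := by exact_mod_cast t.2
          gcongr
          linarith
      _ = M * (n : ℝ) ^ 2 := by simp
  have hcos : 0 < Real.cos (ℓ * x / 2) ^ 2 := by have := hx.2; positivity
  have hsin : (-(ℓ * Real.sin (ℓ * x / 2))) ^ 2 ≤ (ℓ : ℝ) ^ 2 := by
    rw [neg_sq, mul_pow]
    exact mul_le_of_le_one_right (by positivity) (Real.sin_sq_le_one _)
  have hMM : (M : ℝ) = 0 ∨ (1 : ℝ) ≤ M := by
    rcases Nat.eq_zero_or_pos M with h | h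
    · left; exact_mod_cast h
    · right; exact_mod_cast h
  have key := abs_zeroDensity_sub_sqrt_mul_le (c := 2 * Real.cos (ℓ * x / 2)) hN hMM
    (add_pos_of_pos_of_nonneg (mul_pos hN (by rw [mul_pow]; exact mul_pos (by norm_num) hcos)) hM0)
    (Finset.sum_nonneg fun _ _ => sq_nonneg _) hR hQs hs0 hsn hsin
  rw [zeroDensity, sum_waveform_sq, sum_waveformDeriv_sq, sum_waveformDeriv_mul_waveform, ← hQ]
  rw [show (m : ℝ) * ℓ * (2 * Real.cos (ℓ * x / 2)) ^ 2 = 4 * (m * ℓ) * Real.cos (ℓ * x / 2) ^ 2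
    by ring] at key ⊢
  set D := 1 + 4 * ((m : ℝ) * ℓ) * Real.cos (ℓ * x / 2) ^ 2 with hD
  have hD0 : 0 < D := by positivity
  have hn1 : (0 : ℝ) < n := by linarith
  refine le_of_mul_le_mul_right ?_ (show (0 : ℝ) < n / 4 by positivity)
  calc _ ≤ _ := mul_le_mul_of_nonneg_left hSn (abs_nonneg _)
    _ ≤ M * ((n : ℝ) ^ 2 + ℓ ^ 2 * (m * ℓ)) / D := key
    _ ≤ 2 * ℓ * ((n : ℝ) ^ 2 + ℓ ^ 2 * n ^ 2) / D := by
        gcongr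
        · linarith
        · nlinarith
    _ = _ := by field_simp; ring

open Real in
/-- The Kac-Rice integral is `2 n / √3 + O(√n)`. -/
lemma abs_integral_zeroDensity_sub_le {ℓ m M n : ℕ} (hℓ : 1 ≤ ℓ) (hM : M < 2 * ℓ)
    (hn : n + 1 = 2 * ℓ * m + M) (hn0 : 20 * ℓ ≤ n) :
    IntegrableOn (fun x => 1 / π * zeroDensity ℓ m M x) (regularPoints ℓ) ∧
    |(∫ x in regularPoints ℓ, 1 / π * zeroDensity ℓ m M x) - 2 * n / √3| ≤
      (8 * ℓ * (1 + ℓ ^ 2) * π + 12 * ℓ) * √n := by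
  obtain ⟨S, hS, hden⟩ := exists_abs_zeroDensity_sub_le hℓ hM hn hn0
  have hℓ' : (1 : ℝ) ≤ ℓ := by exact_mod_cast hℓ
  have hn' : (n : ℝ) + 1 = 2 * ℓ * m + M := by exact_mod_cast hn
  have hn0' : 20 * (ℓ : ℝ) ≤ n := by exact_mod_cast hn0
  have hM' : (M : ℝ) + 1 ≤ 2 * ℓ := by exact_mod_cast hM
  have hn1 : (1 : ℝ) ≤ n := by linarith
  have hK : (n : ℝ) ≤ 4 * (m * ℓ) := by linarith
  have hK0 : (0 : ℝ) < 4 * (m * ℓ) := by linarith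
  set A := 8 * (ℓ : ℝ) * (1 + ℓ ^ 2) * n with hA
  have hA0 : 0 ≤ A := by positivity
  set w : ℝ → ℝ := fun x => 1 / (1 + 4 * (m * ℓ) * cos (ℓ * x / 2) ^ 2) with hw
  have hwc : Continuous w := continuous_const.div (by fun_prop) fun x => by positivity
  have hres : volume.restrict (regularPoints ℓ) = volume.restrict (Set.Ioo 0 (2 * π)) :=
    Measure.restrict_congr_set (regularPoints_ae_eq hℓ)
  have hwi : Integrable w (volume.restrict (regularPoints ℓ)) := by
    rw [hres]
    exact (hwc.integrableOn_Icc (a := 0) (b := 2 * π)).mono_set Set.Ioo_subset_Icc_self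
  have hae : ∀ᵐ x ∂(volume.restrict (regularPoints ℓ)), ‖zeroDensity ℓ m M x - S‖ ≤ A * w x :=
    ae_restrict_of_forall_mem (isOpen_regularPoints ℓ).measurableSet hden
  have hfin : IsFiniteMeasure (volume.restrict (regularPoints ℓ)) := by
    rw [hres]; infer_instance
  have hi : Integrable (fun x => zeroDensity ℓ m M x - S)
      (volume.restrict (regularPoints ℓ)) :=
    (hwi.const_mul A).mono' ((measurable_zeroDensity ℓ m M).sub_const S).aestronglyMeasurable hae
  have hi' : Integrable (zeroDensity ℓ m M) (volume.restrict (regularPoints ℓ)) := by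
    refine (hi.add (integrable_const S)).congr (ae_of_all _ fun x => ?_)
    simp
  refine ⟨hi'.const_mul _, ?_⟩
  have hvol : (volume.restrict (regularPoints ℓ)).real Set.univ = 2 * π := by
    rw [hres]
    simp [pi_pos.le]
  have hsplit : ∫ x in regularPoints ℓ, 1 / π * zeroDensity ℓ m M x
      = 1 / π * (∫ x in regularPoints ℓ, (zeroDensity ℓ m M x - S)) + 2 * S := by
    rw [integral_const_mul, integral_sub hi' (integrable_const S), integral_const, hvol,
      smul_eq_mul]
    field_simp
    ring
  have hbound : |∫ x in regularPoints ℓ, (zeroDensity ℓ m M x - S)| ≤ A * (π ^ 2 / √n) := by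
    calc |∫ x in regularPoints ℓ, (zeroDensity ℓ m M x - S)|
        ≤ ∫ x in regularPoints ℓ, A * w x := norm_integral_le_of_norm_le (hwi.const_mul A) hae
      _ = A * ∫ x in (0 : ℝ)..2 * π, w x := by
          rw [integral_const_mul, hres, intervalIntegral.integral_of_le (by positivity),
            integral_Ioc_eq_integral_Ioo]
      _ ≤ A * (π ^ 2 / √(4 * (m * ℓ))) := by
          gcongr
          exact integral_inv_one_add_mul_cos_sq_le hℓ hK0
      _ ≤ A * (π ^ 2 / √n) := by gcongr
  have hsq : √(n : ℝ) * √n = n := mul_self_sqrt (by positivity)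
  have hsn : (1 : ℝ) ≤ √n := by rw [one_le_sqrt]; exact hn1
  rw [hsplit]
  calc |1 / π * (∫ x in regularPoints ℓ, (zeroDensity ℓ m M x - S)) + 2 * S - 2 * n / √3|
      = |1 / π * (∫ x in regularPoints ℓ, (zeroDensity ℓ m M x - S)) + 2 * (S - n / √3)| := by
        congr 1; ring
    _ ≤ 1 / π * |∫ x in regularPoints ℓ, (zeroDensity ℓ m M x - S)| + 2 * |S - n / √3| := by
        refine (abs_add_le _ _).trans ?_
        rw [abs_mul, abs_mul, abs_of_pos (show 0 < 1 / π by positivity), abs_two]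
    _ ≤ 1 / π * (A * (π ^ 2 / √n)) + 2 * (6 * ℓ) := by gcongr
    _ = 8 * ℓ * (1 + ℓ ^ 2) * π * √n + 12 * ℓ := by
        rw [hA]
        field_simp
        linear_combination (-(8 * (1 + (ℓ : ℝ) ^ 2) * π)) * hsq
    _ ≤ (8 * ℓ * (1 + ℓ ^ 2) * π + 12 * ℓ) * √n := by nlinarith

/-- The Kac-Rice formula for the combinations of waveforms. -/
lemma lintegral_count_zeros_waveform {Ω : Type*} [MeasurableSpace Ω] {P : Measure Ω}
    [IsProbabilityMeasure P] {ℓ m M : ℕ} (hℓ : 1 ≤ ℓ) (hm : 2 ≤ m)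
    {ξ : FreeLabel ℓ m M ⊕ FreeLabel ℓ m M → Ω → ℝ} {v : NNReal} (hv : v ≠ 0)
    (hξ : ∀ i, HasLaw (ξ i) (gaussianReal 0 v) P) (hind : iIndepFun ξ P) :
    ∫⁻ ω, Measure.count (regularPoints ℓ ∩ {x | ∑ i, ξ i ω * waveform ℓ m M i x = 0}) ∂P =
      ∫⁻ x in regularPoints ℓ, ENNReal.ofReal (1 / Real.pi * zeroDensity ℓ m M x) := by
  -- the first cosine waveform is `2 cos (ℓ x / 2) ^ 2`
  let i₀ : FreeLabel ℓ m M ⊕ FreeLabel ℓ m M := Sum.inl (Sum.inl (⟨0, by omega⟩, ⟨0, hℓ⟩))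
  have hi₀ : ∀ x, waveform ℓ m M i₀ x = 2 * Real.cos (ℓ * x / 2) * Real.cos (ℓ * x / 2) := by
    intro x
    simp only [i₀, waveform, amplitude, frequency, Sum.elim_inl]
    norm_num
    left
    ring_nf
  refine lintegral_count_zeros_sum_mul hv hξ hind (isOpen_regularPoints ℓ)
    (hasDerivAt_waveform ℓ m M) (continuous_waveformDeriv ℓ m M) (i₀ := i₀) (fun x hx => ?_)
    fun x hx => ?_
  · have := hx.2
    rw [hi₀]
    positivity
  · -- with at least two pairs the other waveforms do not all vanish at `x`
    rw [hi₀, sum_waveform_sq]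
    have hc : 0 < Real.cos (ℓ * x / 2) ^ 2 := by have := hx.2; positivity
    have h1 : Real.cos (ℓ * x / 2) ^ 2 ≤ 1 := Real.cos_sq_le_one _
    have h2 : (2 : ℝ) ≤ m * ℓ := by exact_mod_cast (by nlinarith : 2 ≤ m * ℓ)
    have h3 : (0 : ℝ) ≤ M := by positivity
    nlinarith

theorem theorem2p2 (ℓ : ℕ) (hℓ : 1 ≤ ℓ) :
    ∃ (C : ℝ) (N₀ : ℕ), ∀ (n m : ℕ) (r : ℤ), N₀ ≤ n → 1 ≤ m →
      -1 ≤ r → r ≤ 2 * (ℓ : ℤ) - 2 → (n : ℤ) = 2 * (ℓ : ℤ) * (m : ℤ) + r →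
      ∀ (Ω : Type*) [MeasurableSpace Ω] (P : Measure Ω) [IsProbabilityMeasure P]
        (σ : NNReal) (a b : ℕ → Ω → ℝ), 0 < σ →
        HasEqualConsecutiveBlocks P ℓ m n σ a b →
        (∀ᵐ ω ∂P, (trigZeros n (fun j => a j ω) (fun j => b j ω)).Finite) ∧
        Integrable (fun ω => (numTrigZeros n (fun j => a j ω) (fun j => b j ω) : ℝ)) P ∧
        |(∫ ω, (numTrigZeros n (fun j => a j ω) (fun j => b j ω) : ℝ) ∂P)
            - 2 * (n : ℝ) / Real.sqrt 3| ≤ C * (n : ℝ) ^ ((4 : ℝ) / 5) := by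
  set Z := (Measure.count (singularPoints ℓ)).toReal with hZ
  set D := 8 * (ℓ : ℝ) * (1 + ℓ ^ 2) * Real.pi + 12 * ℓ with hD
  refine ⟨D + Z, 20 * ℓ, ?_⟩
  intro n m r hn0 _ hr1 hr2 hnr Ω _ P _ σ a b hσ hB
  obtain ⟨M, hMr⟩ : ∃ M : ℕ, (M : ℤ) = r + 1 := ⟨(r + 1).toNat, Int.toNat_of_nonneg (by omega)⟩
  have hM : M < 2 * ℓ := by omega
  have hn : n + 1 = 2 * ℓ * m + M := by
    zify
    linarith
  have hm : 2 ≤ m := by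
    by_contra h
    have h1 : m ≤ 1 := by omega
    have : 2 * ℓ * m ≤ 2 * ℓ * 1 := Nat.mul_le_mul_left _ h1
    omega
  have hv : σ ^ 2 ≠ 0 := by positivity
  -- the free coefficients
  let ξ : FreeLabel ℓ m M ⊕ FreeLabel ℓ m M → Ω → ℝ :=
    Sum.elim (fun κ => a (freePos ℓ m M κ)) fun κ => b (freePos ℓ m M κ)
  have hξ : ∀ i, HasLaw (ξ i) (gaussianReal 0 (σ ^ 2)) P := by
    rintro (κ | κ)
    · exact hB.cos_law _ (freePos_mem_freeIndices hn κ)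
    · exact hB.sin_law _ (freePos_mem_freeIndices hn κ)
  have hind : iIndepFun ξ P := by
    let e : FreeLabel ℓ m M → freeIndices ℓ m n := fun κ =>
      ⟨freePos ℓ m M κ, freePos_mem_freeIndices hn κ⟩
    have he : Function.Injective e := fun κ κ' h =>
      freePos_injective ℓ m M (congrArg Subtype.val h)
    convert hB.indep.precomp (he.sumMap he) using 1
    funext i
    rcases i with κ | κ <;> rfl
  let F : Ω → Set ℝ := fun ω => {x | ∑ i, ξ i ω * waveform ℓ m M i x = 0}
  let N : Ω → ENNReal := fun ω => Measure.count (Set.Ioo 0 (2 * Real.pi) ∩ F ω)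
  have hzeros : ∀ᵐ ω ∂P, trigZeros n (fun j => a j ω) (fun j => b j ω)
      = Set.Ioo 0 (2 * Real.pi) ∩ F ω := by
    have ha : ∀ᵐ ω ∂P, ∀ (j : Fin m) (k : Fin ℓ),
        a (ℓ * (2 * j) + k) ω = a (ℓ * (2 * j + 1) + k) ω :=
      ae_all_iff.2 fun j => ae_all_iff.2 fun k => hB.cos_blocks j j.2 k
    have hb : ∀ᵐ ω ∂P, ∀ (j : Fin m) (k : Fin ℓ),
        b (ℓ * (2 * j) + k) ω = b (ℓ * (2 * j + 1) + k) ω :=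
      ae_all_iff.2 fun j => ae_all_iff.2 fun k => hB.sin_blocks j j.2 k
    filter_upwards [ha, hb] with ω hωa hωb
    ext x
    refine and_congr_right fun _ => ?_
    rw [trigPoly_eq_sum_waveform hn (fun j hj k hk => hωa ⟨j, hj⟩ ⟨k, hk⟩)
      (fun j hj k hk => hωb ⟨j, hj⟩ ⟨k, hk⟩)]
    refine Eq.congr (Finset.sum_congr rfl fun i _ => ?_) rfl
    rcases i with κ | κ <;> rfl
  have hNm : AEMeasurable N P :=
    aemeasurable_count_zeros_sum_mul (fun i => (hξ i).aemeasurable) isOpen_Ioo fun i =>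
      continuous_iff_continuousAt.2 fun x => (hasDerivAt_waveform ℓ m M i x).continuousAt
  obtain ⟨hρi, hρ⟩ := abs_integral_zeroDensity_sub_le hℓ hM hn hn0
  set I := ∫ x in regularPoints ℓ, 1 / Real.pi * zeroDensity ℓ m M x with hI
  have hρ0 : ∀ x, 0 ≤ 1 / Real.pi * zeroDensity ℓ m M x := fun x => by
    rw [zeroDensity]
    have := Real.pi_pos
    positivity
  have hI0 : 0 ≤ I := integral_nonneg hρ0
  have hreg : ∫⁻ ω, Measure.count (regularPoints ℓ ∩ F ω) ∂P = ENNReal.ofReal I := by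
    rw [hI, ofReal_integral_eq_lintegral_ofReal hρi (ae_of_all _ hρ0)]
    exact lintegral_count_zeros_waveform hℓ hm hv hξ hind
  have hZfin : Measure.count (singularPoints ℓ) ≠ ⊤ :=
    (Measure.count_apply_lt_top.2 (finite_singularPoints hℓ)).ne
  have hlow : ENNReal.ofReal I ≤ ∫⁻ ω, N ω ∂P := by
    rw [← hreg]
    refine lintegral_mono fun ω => measure_mono (Set.inter_subset_inter_left _ ?_)
    exact fun x hx => hx.1
  have hupp : ∫⁻ ω, N ω ∂P ≤ ENNReal.ofReal (I + Z) := by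
    calc ∫⁻ ω, N ω ∂P
        ≤ ∫⁻ ω, (Measure.count (regularPoints ℓ ∩ F ω) + Measure.count (singularPoints ℓ)) ∂P := by
          refine lintegral_mono fun ω => ?_
          dsimp only [N]
          rw [← regularPoints_union_singularPoints ℓ, Set.union_inter_distrib_right]
          exact (measure_union_le _ _).trans (add_le_add_right
            (measure_mono Set.inter_subset_left) _)
      _ = ENNReal.ofReal (I + Z) := by
          rw [lintegral_add_right _ measurable_const, hreg, lintegral_const, measure_univ, mul_one,
            ENNReal.ofReal_add hI0 ENNReal.toReal_nonneg, ENNReal.ofReal_toReal hZfin]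
  have hNfin : ∫⁻ ω, N ω ∂P ≠ ⊤ := (hupp.trans_lt ENNReal.ofReal_lt_top).ne
  have hnum : (fun ω => (numTrigZeros n (fun j => a j ω) (fun j => b j ω) : ℝ))
      =ᵐ[P] fun ω => (N ω).toReal := by
    filter_upwards [hzeros, ae_lt_top' hNm hNfin] with ω hω hfin
    have hf : (Set.Ioo 0 (2 * Real.pi) ∩ F ω).Finite := Measure.count_apply_lt_top.1 hfin
    simp only [N]
    rw [numTrigZeros, hω, Measure.count_apply_finite _ hf, Set.ncard_eq_toFinset_card _ hf]
    simp
  refine ⟨?_, ?_, ?_⟩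
  · filter_upwards [hzeros, ae_lt_top' hNm hNfin] with ω hω hfin
    rw [hω]
    exact Measure.count_apply_lt_top.1 hfin
  · exact (integrable_toReal_of_lintegral_ne_top hNm hNfin).congr hnum.symm
  · rw [integral_congr_ae hnum, integral_toReal hNm (ae_lt_top' hNm hNfin)]
    have h1 : I ≤ (∫⁻ ω, N ω ∂P).toReal := (ENNReal.ofReal_le_iff_le_toReal hNfin).1 hlow
    have h2 : (∫⁻ ω, N ω ∂P).toReal ≤ I + Z :=
      ENNReal.toReal_le_of_le_ofReal (add_nonneg hI0 ENNReal.toReal_nonneg) hupp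
    have hn1 : (1 : ℝ) ≤ n := by exact_mod_cast (by omega : 1 ≤ n)
    have hpow : √(n : ℝ) ≤ (n : ℝ) ^ ((4 : ℝ) / 5) := by
      rw [Real.sqrt_eq_rpow]
      exact Real.rpow_le_rpow_of_exponent_le hn1 (by norm_num)
    have hpow1 : (1 : ℝ) ≤ (n : ℝ) ^ ((4 : ℝ) / 5) := Real.one_le_rpow hn1 (by norm_num)
    have hD0 : 0 ≤ D := by
      have := Real.pi_pos
      positivity
    have hZ0 : 0 ≤ Z := ENNReal.toReal_nonneg
    have h3 : D * √(n : ℝ) ≤ D * (n : ℝ) ^ ((4 : ℝ) / 5) := mul_le_mul_of_nonneg_left hpow hD0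
    have h4 : Z ≤ Z * (n : ℝ) ^ ((4 : ℝ) / 5) := le_mul_of_one_le_right hZ0 hpow1
    rw [abs_le] at hρ ⊢
    constructor <;> linarith [hρ.1, hρ.2]
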